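/- Let $(R,\mathfrak m)$ be a Noetherian local normal domain of prime characteristic $p>0$ that is $F$-finite (the Frobenius $F\colon R\to R$ is a finite map). For $e\ge 0$ let $F^e_*R$ be $R$ viewed as an $R$-module via $F^e$. A domain $A$ of characteristic $p$ is called *$F$-pure* if $A\to F_*A$, $1\mapsto F_*1$, splits $A$-linearly, and *$F$-regular* (meaning strongly $F$-regular) if for every $0\neq c\in A$ there is an $e>0$ such that $A\to F^e_*A$, $1\mapsto F^e_*c$, splits $A$-linearly. For a Weil divisor $D$ on $\operatorname{Spec}R$ let $R(D)=\{f\in\operatorname{Frac}(R)\setminus\{0\} : \operatorname{div}(f)+D\ge 0\}\cup\{0\}$. Suppose that $R$ is *$\mathbb Q$-Gorenstein of index $n$*: there is a canonical divisor $K$ (a Weil divisor such that $R(K)$ is a canonical module of $R$, i.e. a finitely generated module whose Matlis dual is the top local cohomology $H^{\dim R}_{\mathfrak m}(R)$), and $n$ is the smallest positive integer with $nK\sim 0$. Suppose that $R$ is $F$-pure but not $F$-regular. If $R_{\mathfrak p}$ is $F$-regular for every prime ideal $\mathfrak p\neq\mathfrak m$, then $p\equiv 1\pmod n$. In particular, $p\equiv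 1\pmod n$ if $R$ has an isolated singularity, that is, if $R_{\mathfrak p}$ is a regular local ring for every prime ideal $\mathfrak p\neq\mathfrak m$. -/

import Mathlib

/-!
Frobenius splittings, strong F-regularity, Weil divisors and divisorial ideals on normal domains,
canonical modules and the Q-Gorenstein index.
-/

universe u

noncomputable section

/-! ### F-singularities -/

/-- The `R`-linear map `R → F^e_* R`, `1 ↦ F^e_* c`, splits. Here `F^e_* R` is the additive group
`R` on which `r : R` acts as multiplication by `r ^ p ^ e`, so a splitting is an additive map
`φ : R → R` with `φ (r ^ p ^ e * s) = r * φ s` and `φ c = 1`. -/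
def FrobeniusSplitsAt (p : ℕ) (R : Type*) [CommRing R] (e : ℕ) (c : R) : Prop :=
  ∃ φ : R →+ R, (∀ r s : R, φ (r ^ p ^ e * s) = r * φ s) ∧ φ c = 1

/-- `R` is F-pure (F-split): the Frobenius map `R → F_* R` splits `R`-linearly. -/
def IsFPure (p : ℕ) (R : Type*) [CommRing R] : Prop :=
  FrobeniusSplitsAt p R 1 1

/-- `R` is strongly F-regular: for every `c` outside all minimal primes there is an `e > 0` such
that `R → F^e_* R`, `1 ↦ F^e_* c`, splits. -/
def IsStronglyFRegular (p : ℕ) (R : Type*) [CommRing R] : Prop :=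
  ∀ c : R, (∀ Q ∈ minimalPrimes R, c ∉ Q) → ∃ e : ℕ, 0 < e ∧ FrobeniusSplitsAt p R e c

/-! ### Canonical modules of local rings -/

/-- `x₁, …, x_d` is a system of parameters of the local ring `R`: `d = dim R`, and the radical of
`(x₁, …, x_d)` is the maximal ideal. -/
def IsSystemOfParameters {R : Type*} [CommRing R] [IsLocalRing R] {d : ℕ} (x : Fin d → R) : Prop :=
  ringKrullDim R = d ∧ (Ideal.span (Set.range x)).radical = IsLocalRing.maximalIdeal R

/-- The canonical map `R[1/∏_{j ≠ i} x_j] → R[1/∏_j x_j]`, a component (up to sign) of the last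
differential of the Čech complex of `x₁, …, x_d`. -/
def cechMap {R : Type*} [CommRing R] {d : ℕ} (x : Fin d → R) (i : Fin d) :
    Localization.Away (∏ j ∈ Finset.univ.erase i, x j) →ₐ[R] Localization.Away (∏ j, x j) :=
  IsLocalization.liftAlgHom (M := Submonoid.powers (∏ j ∈ Finset.univ.erase i, x j))
    (f := Algebra.ofId R (Localization.Away (∏ j, x j))) (by
      rintro ⟨_, k, rfl⟩
      have h : IsUnit (algebraMap R (Localization.Away (∏ j, x j)) (∏ j, x j)) :=
        IsLocalization.Away.algebraMap_isUnit _
      have h' : IsUnit (algebraMap R (Localization.Away (∏ j, x j))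
          (∏ j ∈ Finset.univ.erase i, x j)) :=
        isUnit_of_dvd_unit (map_dvd _ (Finset.prod_dvd_prod_of_subset _ _ _
          (Finset.erase_subset i Finset.univ))) h
      have h'' := h'.pow k
      rw [← map_pow] at h''
      exact h'')

/-- The top Čech cohomology `Coker (⨁ᵢ R[1/∏_{j ≠ i} x_j] → R[1/∏_j x_j])` of `R` with respect to
`x₁, …, x_d`. For a system of parameters of a Noetherian local ring `(R, 𝔪)` this is the top local
cohomology module `H^d_𝔪(R)`. -/
abbrev TopCechCohomology {R : Type*} [CommRing R] {d : ℕ} (x : Fin d → R) : Type _ :=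
  Localization.Away (∏ j, x j) ⧸ ⨆ i, LinearMap.range (cechMap x i).toLinearMap

/-- `E` is an injective hull of the residue field of `R`: an injective module that is an essential
extension of the residue field. -/
def IsInjectiveHullResidueField (R : Type u) [CommRing R] [IsLocalRing R]
    (E : Type u) [AddCommGroup E] [Module R E] : Prop :=
  Module.Injective R E ∧
    ∃ ι : IsLocalRing.ResidueField R →ₗ[R] E, Function.Injective ι ∧
      ∀ N : Submodule R E, N ≠ ⊥ → N ⊓ LinearMap.range ι ≠ ⊥

/-- `ω` is a canonical module of the Noetherian local ring `(R, 𝔪)` of dimension `d`: it is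
finitely generated and its Matlis dual `Hom_R(ω, E)` is isomorphic to `H^d_𝔪(R)`. -/
def IsCanonicalModule (R : Type u) [CommRing R] [IsLocalRing R]
    (ω : Type u) [AddCommGroup ω] [Module R ω] : Prop :=
  Module.Finite R ω ∧
    ∃ (d : ℕ) (x : Fin d → R), IsSystemOfParameters x ∧
      ∃ (E : Type u) (_ : AddCommGroup E) (_ : Module R E), IsInjectiveHullResidueField R E ∧
        Nonempty ((ω →ₗ[R] E) ≃ₗ[R] TopCechCohomology x)

/-! ### Weil divisors on the spectrum of a normal domain -/

/-- Prime divisors of `Spec R`, that is, primes of height one. -/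
abbrev PrimeDivisor (R : Type*) [CommRing R] : Type _ :=
  {P : PrimeSpectrum R // P.asIdeal.height = 1}

/-- Weil divisors on `Spec R`. -/
abbrev WeilDivisor (R : Type*) [CommRing R] : Type _ :=
  PrimeDivisor R →₀ ℤ

namespace PrimeDivisor

variable {R : Type*} [CommRing R]

/-- The local ring of `Spec R` at a prime divisor. -/
abbrev LocalRing (P : PrimeDivisor R) : Type _ := Localization.AtPrime P.1.asIdeal

lemma ringKrullDim_localRing (P : PrimeDivisor R) : ringKrullDim P.LocalRing = 1 := by
  rw [IsLocalization.AtPrime.ringKrullDim_eq_height P.1.asIdeal P.LocalRing, P.2]; rfl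

instance (P : PrimeDivisor R) : Ring.KrullDimLE 1 P.LocalRing := by
  rw [Ring.KrullDimLE, Order.krullDimLE_iff]
  exact (ringKrullDim_localRing P).le

variable [IsDomain R]

instance (P : PrimeDivisor R) : Algebra P.LocalRing (FractionRing R) :=
  IsLocalization.localizationAlgebraOfSubmonoidLe P.LocalRing (FractionRing R)
    P.1.asIdeal.primeCompl (nonZeroDivisors R) P.1.asIdeal.primeCompl_le_nonZeroDivisors

instance (P : PrimeDivisor R) : IsScalarTower R P.LocalRing (FractionRing R) :=
  IsLocalization.localization_isScalarTower_of_submonoid_le P.LocalRing (FractionRing R)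
    P.1.asIdeal.primeCompl (nonZeroDivisors R) P.1.asIdeal.primeCompl_le_nonZeroDivisors

instance (P : PrimeDivisor R) : IsFractionRing P.LocalRing (FractionRing R) :=
  IsFractionRing.isFractionRing_of_isDomain_of_isLocalization P.1.asIdeal.primeCompl
    P.LocalRing (FractionRing R)

/-- The order of vanishing `ord_P(f)` of `f ∈ Frac R` along the prime divisor `P`, that is, the
coefficient of `P` in `div(f)`. (It takes the value `0` at `f = 0`.) -/
def ord [IsNoetherianRing R] (P : PrimeDivisor R) (f : FractionRing R) : ℤ :=
  WithZero.log (Ring.ordFrac P.LocalRing f)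

lemma ord_mul [IsNoetherianRing R] (P : PrimeDivisor R) {f g : FractionRing R} (hf : f ≠ 0)
    (hg : g ≠ 0) : P.ord (f * g) = P.ord f + P.ord g := by
  unfold ord
  rw [map_mul, WithZero.log_mul ((map_ne_zero _).2 hf) ((map_ne_zero _).2 hg)]

lemma ord_algebraMap_nonneg [IsNoetherianRing R] (P : PrimeDivisor R) (r : R) :
    0 ≤ P.ord (algebraMap R (FractionRing R) r) := by
  by_cases hr : r = 0
  · simp [hr, ord]
  have hinj : Function.Injective (algebraMap R P.LocalRing) :=
    IsLocalization.injective _ P.1.asIdeal.primeCompl_le_nonZeroDivisors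
  have h := Ring.ordFrac_ge_one_of_ne_zero (K := FractionRing R)
    (x := algebraMap R P.LocalRing r) (by simpa using hinj.ne hr)
  rw [← IsScalarTower.algebraMap_apply] at h
  have h' := WithZero.log_le_log one_ne_zero (zero_lt_one.trans_le h).ne' |>.2 h
  simpa [ord] using h'

instance [IsNoetherianRing R] [IsIntegrallyClosed R] (P : PrimeDivisor R) :
    IsDiscreteValuationRing P.LocalRing := by
  have hnf : ¬ IsField P.LocalRing := fun h => by
    have h0 := ringKrullDim_eq_zero_of_isField h
    rw [ringKrullDim_localRing P] at h0
    exact one_ne_zero h0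
  have hic : IsIntegrallyClosed P.LocalRing :=
    isIntegrallyClosed_of_isLocalization P.LocalRing P.1.asIdeal.primeCompl
      P.1.asIdeal.primeCompl_le_nonZeroDivisors
  have := (tfae_of_isNoetherianRing_of_isLocalRing_of_isDomain P.LocalRing).out 3 0
  have hpir : IsPrincipalIdealRing P.LocalRing := this.1 ⟨hic, fun Q hQ hQp =>
    IsLocalRing.eq_maximalIdeal (hQp.isMaximal_of_ne_bot hQ)⟩
  exact ((IsDiscreteValuationRing.TFAE P.LocalRing hnf).out 0 1).2
    (((tfae_of_isNoetherianRing_of_isLocalRing_of_isDomain P.LocalRing).out 0 1).1 hpir)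

lemma min_ord_le_ord_add [IsNoetherianRing R] [IsIntegrallyClosed R] (P : PrimeDivisor R)
    {f g : FractionRing R} (hf : f ≠ 0) (hg : g ≠ 0) (h : f + g ≠ 0) :
    min (P.ord f) (P.ord g) ≤ P.ord (f + g) := by
  have key := Ring.ordFrac_add (R := P.LocalRing) f g h
  have h0 {x : FractionRing R} (hx : x ≠ 0) : Ring.ordFrac P.LocalRing x ≠ 0 :=
    (map_ne_zero _).2 hx
  rcases min_le_iff.1 key with h1 | h1
  · exact min_le_iff.2 (Or.inl ((WithZero.log_le_log (h0 hf) (h0 h)).2 h1))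
  · exact min_le_iff.2 (Or.inr ((WithZero.log_le_log (h0 hg) (h0 h)).2 h1))

end PrimeDivisor

namespace WeilDivisor

variable {R : Type*} [CommRing R] [IsDomain R] [IsNoetherianRing R]

/-- The divisor `D` is principal, `D ∼ 0`: there is `f ≠ 0` in `Frac R` with `D = div(f)`. -/
def IsPrincipal (D : WeilDivisor R) : Prop :=
  ∃ f : FractionRing R, f ≠ 0 ∧ ∀ P, D P = P.ord f

/-- The divisorial ideal `R(D) = {f ∈ Frac R ∖ {0} | div(f) + D ≥ 0} ∪ {0}`. -/
def divisorialIdeal [IsIntegrallyClosed R] (D : WeilDivisor R) : Submodule R (FractionRing R) where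
  carrier := {f | f ≠ 0 → ∀ P, 0 ≤ PrimeDivisor.ord P f + D P}
  zero_mem' := fun h => absurd rfl h
  add_mem' := by
    intro f g hf hg hfg P
    by_cases hf0 : f = 0
    · subst hf0
      rw [zero_add] at hfg ⊢
      exact hg hfg P
    by_cases hg0 : g = 0
    · subst hg0
      rw [add_zero] at hfg ⊢
      exact hf hfg P
    have h1 := hf hf0 P
    have h2 := hg hg0 P
    have h3 := P.min_ord_le_ord_add hf0 hg0 hfg
    rcases min_le_iff.1 h3 with h | h <;> linarith
  smul_mem' := by
    intro r f hf hrf P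
    rw [Algebra.smul_def] at hrf ⊢
    have h1 := hf (right_ne_zero_of_mul hrf) P
    have h2 := P.ord_algebraMap_nonneg r
    rw [P.ord_mul (left_ne_zero_of_mul hrf) (right_ne_zero_of_mul hrf)]
    linarith

end WeilDivisor

/-! ### The index -/

/-- `K` is a canonical divisor of the local normal domain `R`: `R(K)` is a canonical module. -/
def IsCanonicalDivisor {R : Type u} [CommRing R] [IsDomain R] [IsNoetherianRing R]
    [IsIntegrallyClosed R] [IsLocalRing R] (K : WeilDivisor R) : Prop :=
  IsCanonicalModule R K.divisorialIdeal

/-- `R` is `ℚ`-Gorenstein of index `n`: it has a canonical divisor `K`, and `n` is the smallest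
positive integer with `n K ∼ 0`. -/
def IsQGorensteinOfIndex (R : Type u) [CommRing R] [IsDomain R] [IsNoetherianRing R]
    [IsIntegrallyClosed R] [IsLocalRing R] (n : ℕ) : Prop :=
  ∃ K : WeilDivisor R, IsCanonicalDivisor K ∧
    IsLeast {m : ℕ | 0 < m ∧ WeilDivisor.IsPrincipal (m • K)} n

end

/-!
A canonical divisor `K` comes with a trace of Frobenius `T : Frac R → Frac R`, a map with
`T (a ^ p * f) = a * T f` that preserves `R(K)` and through which every `R`-linear map `F_* R → R`
has the form `T (f * ·)`; then the divisor `D = div f - (p - 1) K` is effective. The claim is that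
`D = 0` when `T (f * ·)` is a Frobenius splitting, so that `(p - 1) K ∼ 0` and the index `n` divides
`p - 1`.

The proof that `D = 0` uses that every `R`-linear map `F^e_* R → R` sends the maximal ideal `𝔪` into
itself (`IsFrobeniusInverseLinear.apply_mem_maximalIdeal`). This holds because `R` is F-pure and
strongly F-regular on the punctured spectrum: for `c ≠ 0` the values `ψ c` of all maps
`ψ : F^e_* R → R` form an ideal that contains a power of `𝔪` for large `e`, and if some map took the
value `1` on `𝔪`, its iterates would take the value `1` at elements of every power of `𝔪`, so that
`R` would be strongly F-regular.
Now choose `b` and `e > 0` with `n ∣ p ^ b * (p ^ e - 1)`, and `g` with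
`div g = p ^ b * (p ^ e - 1) * K`. The `b`-th iterate of the splitting is represented by a power of
`f`. Multiplication by this power and by `g`, followed by the `(b + e)`-th iterate of `T`, is a map
`F^(b + e)_* R → R`. It takes the value `1` at an element `u ∈ R` whose divisor is a positive
multiple of `D`. So `u` is a unit and `D = 0` (`WeilDivisor.isPrincipal_sub_one_smul`).

The trace is obtained from the duality `F_* ω ≅ Hom_R(F_* R, ω)` for `ω = R(K)`. This is a case of
`nonempty_linearEquiv_coextension`, duality for a finite local homomorphism `R → S`: the modules
`ω_S` and `Hom_R(S, ω_R)` have isomorphic Matlis duals, because `Hom_R(S, E_R)` is the injective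
hull `E_S`, because `Hom_S(Hom_R(S, ω), Hom_R(S, E)) ≅ S ⊗ Hom_R(ω, E)`, and because the top Čech
cohomology commutes with base change; finitely generated modules with isomorphic Matlis duals are
isomorphic, even when the ring is not complete
(`IsInjectiveHullResidueField.nonempty_linearEquiv_of_dual_of_finite`). For `S = F_* R` the Čech
cohomology with respect to `x ^ p` is that with respect to `x`.

The assertion on isolated singularities follows since an F-finite regular local ring `S` is strongly
F-regular: a regular system of parameters is a regular sequence on `F^e_* S`, which is therefore
free over `S` (`IsRegularLocalRing.isStronglyFRegular`).
-/

/-! ### Lifting homomorphisms from a quotient -/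

section Lifting

variable {R : Type*} [CommRing R]

/-- `Hom(M / I M, E)` is the submodule of `Hom(M, E)` killed by `I`. -/
def dualQuotientEquiv (I : Ideal R) (M E : Type*) [AddCommGroup M] [Module R M] [AddCommGroup E]
    [Module R E] :
    ((M ⧸ (I • ⊤ : Submodule R M)) →ₗ[R] E) ≃ₗ[R]
      Submodule.torsionBySet R (M →ₗ[R] E) (I : Set R) where
  toFun f := ⟨f ∘ₗ Submodule.mkQ _, by
    rw [Submodule.mem_torsionBySet_iff]
    rintro ⟨a, ha⟩
    ext m
    have h : (Submodule.Quotient.mk (a • m) : M ⧸ (I • ⊤ : Submodule R M)) = 0 :=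
      (Submodule.Quotient.mk_eq_zero _).2 (Submodule.smul_mem_smul ha trivial)
    change a • f (Submodule.Quotient.mk m) = 0
    rw [← map_smul, ← Submodule.Quotient.mk_smul, h, map_zero]⟩
  map_add' _ _ := rfl
  map_smul' _ _ := rfl
  invFun g := Submodule.liftQ _ g.1 (Submodule.smul_le.2 fun a ha m _ => by
    have h := (Submodule.mem_torsionBySet_iff _ _).1 g.2 ⟨a, ha⟩
    rw [LinearMap.mem_ker, map_smul]
    exact LinearMap.congr_fun h m)
  left_inv f := by
    ext m
    rfl
  right_inv g := by
    ext m
    rfl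

/-- The restriction of a linear equivalence to the parts killed by an ideal. -/
def torsionBySetEquiv (I : Set R) {M N : Type*} [AddCommGroup M] [Module R M] [AddCommGroup N]
    [Module R N] (e : M ≃ₗ[R] N) :
    Submodule.torsionBySet R M I ≃ₗ[R] Submodule.torsionBySet R N I :=
  e.ofSubmodules _ _ (by
    ext y
    simp only [Submodule.mem_map, Submodule.mem_torsionBySet_iff]
    constructor
    · rintro ⟨x, hx, rfl⟩ a
      have := congrArg e (hx a)
      simpa using this
    · intro hy
      refine ⟨e.symm y, fun a => ?_, by simp⟩
      have := congrArg e.symm (hy a)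
      simpa using this)

/-- By Artin–Rees, for large `k` every homomorphism `M → N / I ^ k N` agrees modulo `I N` with a
homomorphism `M → N`. -/
lemma exists_forall_exists_lift [IsNoetherianRing R] (I : Ideal R) (M N : Type*)
    [AddCommGroup M] [Module R M] [AddCommGroup N] [Module R N] [Module.Finite R M]
    [Module.Finite R N] :
    ∃ k : ℕ, k ≠ 0 ∧ ∀ f : M →ₗ[R] N ⧸ (I ^ k • ⊤ : Submodule R N), ∃ g : M →ₗ[R] N,
      ∀ m, ∀ n : N, Submodule.Quotient.mk n = f m → g m - n ∈ (I • ⊤ : Submodule R N) := by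
  obtain ⟨b, π, hπ⟩ := Module.Finite.exists_fin' R M
  obtain ⟨a, ρ, hρ⟩ := Module.Finite.exists_fin' R (LinearMap.ker π)
  -- `A` sends the images of the generators of `M` to the images of the generating relations.
  let rel : Fin a → Fin b → R := fun i => (ρ (Pi.single i 1)).1
  let A : (Fin b → N) →ₗ[R] (Fin a → N) :=
    LinearMap.pi fun i => ∑ j, rel i j • LinearMap.proj j
  have hA (x : Fin b → N) (i : Fin a) : A x i = ∑ j, rel i j • x j := by simp [A]
  have hker (x : Fin b → N) (hx : A x = 0) :
      LinearMap.ker π ≤ LinearMap.ker (Fintype.linearCombination R x) := by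
    intro v hv
    obtain ⟨w, hw⟩ := hρ ⟨v, hv⟩
    have hv' : v = ∑ i, w i • rel i := by
      have h1 : w = ∑ i, w i • Pi.single (M := fun _ : Fin a => R) i 1 := by
        ext j; simp [Finset.sum_apply, Pi.single_apply]
      have h2 : v = (ρ w).1 := by rw [hw]
      rw [h2]
      conv_lhs => rw [h1]
      simp [rel]
    rw [LinearMap.mem_ker, hv', map_sum]
    refine Finset.sum_eq_zero fun i _ => ?_
    rw [map_smul, Fintype.linearCombination_apply, ← hA, hx]
    simp
  obtain ⟨c, hc⟩ := Ideal.exists_pow_inf_eq_pow_smul I (LinearMap.range A)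
  refine ⟨c + 1, by lia, fun f => ?_⟩
  choose x hx using fun j => Submodule.Quotient.mk_surjective _ (f (π (Pi.single j 1)))
  have hxker (i : Fin a) : A x i ∈ (I ^ (c + 1) • ⊤ : Submodule R N) := by
    rw [← Submodule.Quotient.mk_eq_zero, hA, ← Submodule.mkQ_apply, map_sum]
    simp only [map_smul, Submodule.mkQ_apply, hx]
    have h1 : (∑ j, rel i j • f (π (Pi.single j 1))) = f (π (rel i)) := by
      conv_rhs => rw [pi_eq_sum_univ' (rel i)]
      simp [map_sum]
    rw [h1, show π (rel i) = 0 from (ρ (Pi.single i 1)).2, map_zero]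
  have hAx : A x ∈ (I ^ (c + 1) • ⊤ : Submodule R (Fin a → N)) := by
    rw [show A x = ∑ i, LinearMap.single R (fun _ : Fin a => N) i (A x i) from
      (Finset.univ_sum_single (A x)).symm]
    refine Submodule.sum_mem _ fun i _ => ?_
    have h1 := Submodule.mem_map_of_mem (f := LinearMap.single R (fun _ : Fin a => N) i) (hxker i)
    rw [Submodule.map_smul''] at h1
    exact Submodule.smul_mono le_rfl le_top h1
  have hAx' : A x ∈ I • LinearMap.range A := by
    have h1 : A x ∈ I ^ (c + 1) • ⊤ ⊓ LinearMap.range A := ⟨hAx, x, rfl⟩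
    rw [hc (c + 1) (Nat.le_succ c), Nat.add_sub_cancel_left, pow_one] at h1
    exact Submodule.smul_mono le_rfl inf_le_right h1
  rw [LinearMap.range_eq_map, ← Submodule.map_smul''] at hAx'
  obtain ⟨y, hy, hyx⟩ := hAx'
  have hz : A (x - y) = 0 := by rw [map_sub, hyx, sub_self]
  let g : M →ₗ[R] N := (LinearMap.ker π).liftQ _ (hker _ hz) ∘ₗ
    (π.quotKerEquivOfSurjective hπ).symm.toLinearMap
  have hg (v : Fin b → R) : g (π v) = Fintype.linearCombination R (x - y) v := by
    have : (π.quotKerEquivOfSurjective hπ).symm (π v) = Submodule.Quotient.mk v := by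
      rw [LinearEquiv.symm_apply_eq]; rfl
    simp only [g, LinearMap.comp_apply, LinearEquiv.coe_coe, this]
    rfl
  refine ⟨g, fun m n hmn => ?_⟩
  obtain ⟨v, rfl⟩ := hπ m
  have h1 : (∑ j, v j • x j) - n ∈ (I • ⊤ : Submodule R N) := by
    refine Submodule.smul_mono_left (Ideal.pow_le_self (Nat.succ_ne_zero c)) ?_
    rw [← Submodule.Quotient.mk_eq_zero, Submodule.Quotient.mk_sub, hmn, sub_eq_zero,
      ← Submodule.mkQ_apply, map_sum]
    simp only [map_smul, Submodule.mkQ_apply, hx]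
    conv_rhs => rw [pi_eq_sum_univ' v]
    simp [map_sum]
  have h2 : ∑ j, v j • y j ∈ (I • ⊤ : Submodule R N) := by
    refine Submodule.sum_mem _ fun j _ => Submodule.smul_mem _ _ ?_
    have h3 := Submodule.mem_map_of_mem (f := LinearMap.proj (R := R) (φ := fun _ : Fin b => N) j)
      hy
    rw [Submodule.map_smul''] at h3
    exact Submodule.smul_mono le_rfl le_top h3
  have h3 := Submodule.sub_mem _ h1 h2
  rw [hg, Fintype.linearCombination_apply]
  convert h3 using 1
  simp only [Pi.sub_apply, smul_sub, Finset.sum_sub_distrib]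
  abel

end Lifting

/-! ### Matlis duality for modules of finite length -/

section InjectiveHull

variable {R : Type u} [CommRing R]

/-- `Hom_R(-, E)` is exact when `E` is injective. -/
lemma Module.Injective.exact_lcomp (E : Type u) [AddCommGroup E] [Module R E]
    [Module.Injective R E] {A B C : Type*} [AddCommGroup A] [AddCommGroup B] [AddCommGroup C]
    [Module R A] [Module R B] [Module R C] {f : A →ₗ[R] B} {g : B →ₗ[R] C}
    (h : Function.Exact f g) :
    Function.Exact (LinearMap.lcomp R E g) (LinearMap.lcomp R E f) := by
  intro φ
  constructor
  · intro hφ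
    have hle : LinearMap.ker g ≤ LinearMap.ker φ := by
      rw [LinearMap.exact_iff.1 h]
      rintro _ ⟨a, rfl⟩
      exact LinearMap.congr_fun hφ a
    obtain ⟨ψ, hψ⟩ := Module.Injective.extension_property R E _ _
      ((LinearMap.ker g).liftQ g le_rfl)
      (LinearMap.ker_eq_bot.1 (Submodule.ker_liftQ_eq_bot _ _ _ le_rfl))
      ((LinearMap.ker g).liftQ φ hle)
    refine ⟨ψ, LinearMap.ext fun b => ?_⟩
    exact LinearMap.congr_fun hψ (Submodule.Quotient.mk b)
  · rintro ⟨ψ, rfl⟩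
    ext a
    simp [h.apply_apply_eq_zero]

variable [IsLocalRing R] {E : Type u} [AddCommGroup E] [Module R E]

open IsLocalRing

namespace IsInjectiveHullResidueField

/-- Every element of the injective hull of the residue field is killed by a power of each element
of the maximal ideal: if `a ^ n • R • e` meets the kernel of multiplication by `a` trivially, then
it does not meet the residue field. -/
lemma exists_pow_smul_eq_zero [IsNoetherianRing R] (hE : IsInjectiveHullResidueField R E)
    {a : R} (ha : a ∈ maximalIdeal R) (e : E) : ∃ n : ℕ, a ^ n • e = 0 := by
  obtain ⟨-, ι, -, hess⟩ := hE
  let F : ℕ →o Ideal R :=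
    ⟨fun n => LinearMap.ker (LinearMap.toSpanSingleton R E (a ^ n • e)),
      monotone_nat_of_le_succ fun n r hr => by
        simp only [LinearMap.mem_ker, LinearMap.toSpanSingleton_apply] at hr ⊢
        rw [pow_succ', mul_smul, smul_comm, hr, smul_zero]⟩
  obtain ⟨n, hn⟩ := monotone_stabilizes_iff_noetherian.2 ‹IsNoetherianRing R› F
  refine ⟨n, by_contra fun hne => ?_⟩
  refine hess (R ∙ (a ^ n • e)) (by simpa [Submodule.span_singleton_eq_bot] using hne) ?_
  rw [eq_bot_iff]
  rintro x ⟨hx, y, rfl⟩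
  obtain ⟨r, hr⟩ := Submodule.mem_span_singleton.1 hx
  have hay : a • ι y = 0 := by
    rw [← map_smul, Algebra.smul_def, ResidueField.algebraMap_eq, (residue_eq_zero_iff a).2 ha,
      zero_mul, map_zero]
  have h1 : r ∈ F (n + 1) := by
    change r • (a ^ (n + 1) • e) = 0
    rw [pow_succ', mul_smul, smul_comm, hr, hay]
  rw [← hn (n + 1) (Nat.le_succ n)] at h1
  rw [Submodule.mem_bot, ← hr]
  exact h1

/-- The socle of the injective hull is the residue field. -/
lemma mem_range_of_forall_smul_eq_zero {ι : ResidueField R →ₗ[R] E}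
    (hess : ∀ N : Submodule R E, N ≠ ⊥ → N ⊓ LinearMap.range ι ≠ ⊥) {e : E}
    (he : ∀ a ∈ maximalIdeal R, a • e = 0) : e ∈ LinearMap.range ι := by
  by_cases h0 : e = 0
  · simp [h0]
  obtain ⟨x, ⟨hx, hxι⟩, hx0⟩ := Submodule.exists_mem_ne_zero_of_ne_bot
    (hess (R ∙ e) (by simpa [Submodule.span_singleton_eq_bot] using h0))
  obtain ⟨r, rfl⟩ := Submodule.mem_span_singleton.1 hx
  have hr : IsUnit r := by
    by_contra hr
    exact hx0 (he r hr)
  obtain ⟨s, hs⟩ := hr.exists_left_inv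
  have := Submodule.smul_mem _ s hxι
  rwa [smul_smul, hs, one_smul] at this

/-- The injective hull of the residue field cogenerates. -/
lemma exists_apply_ne_zero (hE : IsInjectiveHullResidueField R E) {X : Type*} [AddCommGroup X]
    [Module R X] {x : X} (hx : x ≠ 0) : ∃ f : X →ₗ[R] E, f x ≠ 0 := by
  obtain ⟨hinj, ι, hι, -⟩ := hE
  have hker : LinearMap.ker (LinearMap.toSpanSingleton R X x) ≤ maximalIdeal R := by
    refine le_maximalIdeal fun h => hx ?_
    have h1 : (1 : R) ∈ LinearMap.ker (LinearMap.toSpanSingleton R X x) := h ▸ Submodule.mem_top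
    simpa using h1
  let g : (R ⧸ LinearMap.ker (LinearMap.toSpanSingleton R X x)) →ₗ[R] E :=
    ι ∘ₗ Submodule.liftQ _ (Algebra.linearMap R (ResidueField R)) (fun r hr => by
      simpa using hker hr)
  obtain ⟨f, hf⟩ := Module.Injective.extension_property R E _ _
    ((LinearMap.ker (LinearMap.toSpanSingleton R X x)).liftQ _ le_rfl)
    (LinearMap.ker_eq_bot.1 (Submodule.ker_liftQ_eq_bot _ _ _ le_rfl)) g
  refine ⟨f, ?_⟩
  have h1 := LinearMap.congr_fun hf (Submodule.Quotient.mk 1)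
  have h2 : f x = ι 1 := by
    rw [LinearMap.comp_apply, Submodule.liftQ_apply, LinearMap.toSpanSingleton_apply,
      one_smul] at h1
    rw [h1, LinearMap.comp_apply, Submodule.liftQ_apply, Algebra.linearMap_apply, map_one]
  rw [h2]
  exact (map_ne_zero_iff ι hι).2 one_ne_zero

lemma length_dual_le_of_isSimpleModule (hE : IsInjectiveHullResidueField R E) (X : Type*)
    [AddCommGroup X] [Module R X] [IsSimpleModule R X] : Module.length R (X →ₗ[R] E) ≤ 1 := by
  obtain ⟨-, ι, hι, hess⟩ := hE
  have : Nontrivial X := IsSimpleModule.nontrivial R X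
  obtain ⟨x, hx⟩ := exists_ne (0 : X)
  have hsurj := IsSimpleModule.toSpanSingleton_surjective R hx
  have hmax := IsSimpleModule.ker_toSpanSingleton_isMaximal R hx
  have hker := IsLocalRing.eq_maximalIdeal hmax
  let ev : (X →ₗ[R] E) →ₗ[R] LinearMap.range ι :=
    LinearMap.codRestrict _ (LinearMap.applyₗ x) fun f =>
      mem_range_of_forall_smul_eq_zero hess fun a ha => by
        rw [← hker] at ha
        have : a • x = 0 := by simpa using ha
        simp [← map_smul, this]
  have hev : Function.Injective ev := by
    rw [injective_iff_map_eq_zero]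
    intro f hf
    have hfx : f x = 0 := congrArg Subtype.val hf
    ext y
    obtain ⟨r, rfl⟩ := hsurj y
    simp [hfx]
  have hs : IsSimpleModule R (ResidueField R) :=
    isSimpleModule_iff_isCoatom.2 (maximalIdeal.isMaximal R).out
  refine (Module.length_le_of_injective ev hev).trans ?_
  rw [← (LinearEquiv.ofInjective ι hι).length_eq, Module.length_eq_one]

/-- Matlis duality does not increase lengths. -/
lemma length_dual_le (hE : IsInjectiveHullResidueField R E) {X : Type*} [AddCommGroup X]
    [Module R X] (hX : IsFiniteLength R X) :
    Module.length R (X →ₗ[R] E) ≤ Module.length R X := by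
  have hinj := hE.1
  induction hX with
  | of_subsingleton => simp [Module.length_eq_zero]
  | @of_simple_quotient M _ _ N _ _ ih =>
    have hexact : Function.Exact N.subtype N.mkQ := LinearMap.exact_subtype_mkQ N
    have h1 := Module.length_eq_add_of_exact (LinearMap.lcomp R E N.mkQ)
      (LinearMap.lcomp R E N.subtype)
      (LinearMap.lcomp_injective_of_surjective _ N.mkQ_surjective)
      (fun f => Module.Injective.extension_property R E _ _ N.subtype N.subtype_injective f)
      (Module.Injective.exact_lcomp E hexact)
    have h2 := Module.length_eq_add_of_exact N.subtype N.mkQ N.subtype_injective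
      N.mkQ_surjective hexact
    rw [h1, h2, add_comm]
    refine add_le_add ih ?_
    rw [Module.length_eq_one R (M ⧸ N)]
    exact length_dual_le_of_isSimpleModule hE (M ⧸ N)

/-- Modules of finite length are reflexive for Matlis duality. -/
lemma bijective_eval (hE : IsInjectiveHullResidueField R E) {X : Type*} [AddCommGroup X]
    [Module R X] (hX : IsFiniteLength R X) :
    Function.Bijective (LinearMap.applyₗ : X →ₗ[R] (X →ₗ[R] E) →ₗ[R] E) := by
  have hi : Function.Injective (LinearMap.applyₗ : X →ₗ[R] (X →ₗ[R] E) →ₗ[R] E) := by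
    rw [injective_iff_map_eq_zero]
    intro x hx
    by_contra h0
    obtain ⟨f, hf⟩ := hE.exists_apply_ne_zero h0
    exact hf (LinearMap.congr_fun hx f)
  refine ⟨hi, ?_⟩
  have hlt := Module.length_ne_top_iff.2 hX
  have hX' : IsFiniteLength R (X →ₗ[R] E) :=
    Module.length_ne_top_iff.1 (ne_top_of_le_ne_top hlt (hE.length_dual_le hX))
  have hle := (hE.length_dual_le hX').trans (hE.length_dual_le hX)
  rw [Module.length_eq_add_of_exact _ _ hi (Submodule.mkQ_surjective _)
    (LinearMap.exact_map_mkQ_range (LinearMap.applyₗ : X →ₗ[R] (X →ₗ[R] E) →ₗ[R] E))] at hle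
  have h0 : Module.length R (((X →ₗ[R] E) →ₗ[R] E) ⧸
      LinearMap.range (LinearMap.applyₗ : X →ₗ[R] (X →ₗ[R] E) →ₗ[R] E)) = 0 := by
    rw [← nonpos_iff_eq_zero]
    exact (ENat.add_le_add_iff_left hlt).1 (by rwa [add_zero])
  rw [Module.length_eq_zero_iff, Submodule.Quotient.subsingleton_iff] at h0
  exact LinearMap.range_eq_top.1 h0

/-- Two modules of finite length with isomorphic Matlis duals are isomorphic. -/
lemma nonempty_linearEquiv_of_dual (hE : IsInjectiveHullResidueField R E) {X Y : Type*}
    [AddCommGroup X] [Module R X] [AddCommGroup Y] [Module R Y] (hX : IsFiniteLength R X)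
    (hY : IsFiniteLength R Y) (e : (X →ₗ[R] E) ≃ₗ[R] (Y →ₗ[R] E)) : Nonempty (X ≃ₗ[R] Y) :=
  ⟨(LinearEquiv.ofBijective _ (hE.bijective_eval hX)).trans
    ((LinearEquiv.congrLeft E R e).trans
      (LinearEquiv.ofBijective _ (hE.bijective_eval hY)).symm)⟩

end IsInjectiveHullResidueField

/-! ### Finitely generated modules with isomorphic Matlis duals -/

lemma isFiniteLength_quotient_pow_smul_top [IsNoetherianRing R] (M : Type*) [AddCommGroup M]
    [Module R M] [Module.Finite R M] (k : ℕ) (hk : k ≠ 0) :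
    IsFiniteLength R (M ⧸ (maximalIdeal R ^ k • ⊤ : Submodule R M)) := by
  have hnt : Nontrivial (R ⧸ maximalIdeal R ^ k) := Ideal.Quotient.nontrivial_iff.2 fun h =>
    (maximalIdeal.isMaximal R).ne_top (top_le_iff.1 (h ▸ Ideal.pow_le_self hk))
  have hloc : IsLocalRing (R ⧸ maximalIdeal R ^ k) :=
    .of_surjective' (Ideal.Quotient.mk _) Ideal.Quotient.mk_surjective
  have hart : IsArtinianRing (R ⧸ maximalIdeal R ^ k) := by
    rw [isArtinianRing_iff_isNilpotent_maximalIdeal]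
    refine ⟨k, ?_⟩
    rw [← IsLocalRing.map_maximalIdeal_of_surjective (Ideal.Quotient.mk (maximalIdeal R ^ k))
      Ideal.Quotient.mk_surjective, ← Ideal.map_pow]
    exact Ideal.map_quotient_self _
  rw [isFiniteLength_iff_isNoetherian_isArtinian]
  have hf : Module.Finite (R ⧸ maximalIdeal R ^ k)
    (M ⧸ (maximalIdeal R ^ k • ⊤ : Submodule R M)) := Module.Finite.of_restrictScalars_finite R _ _
  exact ⟨inferInstance, isArtinian_of_surjective_algebraMap (R := R ⧸ maximalIdeal R ^ k)
    Ideal.Quotient.mk_surjective⟩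

/-- If `M / 𝔪 ^ k M` and `N / 𝔪 ^ k N` are isomorphic for every `k`, there is a surjection
`M → N`. -/
lemma exists_surjective_of_forall_quotient_equiv [IsNoetherianRing R] (M N : Type*)
    [AddCommGroup M] [Module R M] [AddCommGroup N] [Module R N] [Module.Finite R M]
    [Module.Finite R N]
    (h : ∀ k ≠ 0, Nonempty ((M ⧸ (maximalIdeal R ^ k • ⊤ : Submodule R M)) ≃ₗ[R]
      (N ⧸ (maximalIdeal R ^ k • ⊤ : Submodule R N)))) :
    ∃ g : M →ₗ[R] N, Function.Surjective g := by
  obtain ⟨k, hk, hlift⟩ := exists_forall_exists_lift (maximalIdeal R) M N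
  obtain ⟨φ⟩ := h k hk
  obtain ⟨g, hg⟩ := hlift (φ.toLinearMap ∘ₗ Submodule.mkQ _)
  refine ⟨g, g.surjective_of_surjective_comp_mkQ (maximalIdeal R)
    (IsLocalRing.maximalIdeal_le_jacobson _) fun n' => ?_⟩
  obtain ⟨n, rfl⟩ := Submodule.Quotient.mk_surjective _ n'
  obtain ⟨m, hm⟩ := (φ.surjective.comp (Submodule.mkQ_surjective _)) (Submodule.Quotient.mk n)
  exact ⟨m, (Submodule.Quotient.eq _).2 (hg m n hm.symm)⟩

/-- Finitely generated modules over a Noetherian local ring with isomorphic Matlis duals are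
isomorphic. -/
theorem IsInjectiveHullResidueField.nonempty_linearEquiv_of_dual_of_finite [IsNoetherianRing R]
    (hE : IsInjectiveHullResidueField R E) (M N : Type*)
    [AddCommGroup M] [Module R M] [AddCommGroup N] [Module R N] [Module.Finite R M]
    [Module.Finite R N] (e : (M →ₗ[R] E) ≃ₗ[R] (N →ₗ[R] E)) : Nonempty (M ≃ₗ[R] N) := by
  have h (k : ℕ) (hk : k ≠ 0) : Nonempty ((M ⧸ (maximalIdeal R ^ k • ⊤ : Submodule R M)) ≃ₗ[R]
      (N ⧸ (maximalIdeal R ^ k • ⊤ : Submodule R N))) :=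
    hE.nonempty_linearEquiv_of_dual (isFiniteLength_quotient_pow_smul_top M k hk)
      (isFiniteLength_quotient_pow_smul_top N k hk)
      ((dualQuotientEquiv _ M E).trans
        ((torsionBySetEquiv _ e).trans (dualQuotientEquiv _ N E).symm))
  obtain ⟨g, hg⟩ := exists_surjective_of_forall_quotient_equiv M N h
  obtain ⟨g', hg'⟩ := exists_surjective_of_forall_quotient_equiv N M fun k hk =>
    (h k hk).map LinearEquiv.symm
  have hinj : Function.Injective (g' ∘ₗ g) :=
    IsNoetherian.injective_of_surjective_endomorphism _ (hg'.comp hg)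
  exact ⟨LinearEquiv.ofBijective g ⟨Function.Injective.of_comp hinj, hg⟩⟩

end InjectiveHull

/-! ### Coextension of scalars along a finite local homomorphism -/

section Coextension

open IsLocalRing TensorProduct

variable {R S : Type u} [CommRing R] [CommRing S] [Algebra R S]

/-- The `S`-module structure on the coextension `Hom_R(S, M)`, given by `(s • h) t = h (t * s)`. -/
@[reducible]
def coextensionModule (R S M : Type*) [CommRing R] [CommRing S] [Algebra R S] [AddCommGroup M]
    [Module R M] : Module S (S →ₗ[R] M) where
  smul s h := h ∘ₗ LinearMap.mulRight R s
  one_smul h := by ext t; change h (t * 1) = h t; rw [mul_one]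
  mul_smul a b h := by ext t; change h (t * (a * b)) = h (t * a * b); rw [mul_assoc]
  smul_zero s := rfl
  smul_add s g h := rfl
  add_smul a b h := by ext t; change h (t * (a + b)) = h (t * a) + h (t * b); rw [mul_add, map_add]
  zero_smul h := by ext t; change h (t * 0) = 0; rw [mul_zero, map_zero]

attribute [local instance] coextensionModule

lemma coextension_smul_apply {M : Type*} [AddCommGroup M] [Module R M] (s : S) (h : S →ₗ[R] M)
    (t : S) : (s • h) t = h (t * s) := rfl

lemma coextension_isScalarTower (M : Type*) [AddCommGroup M] [Module R M] :
    IsScalarTower R S (S →ₗ[R] M) where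
  smul_assoc r s h := by
    ext t
    rw [coextension_smul_apply, LinearMap.smul_apply, coextension_smul_apply,
      Algebra.mul_smul_comm, map_smul]

attribute [local instance] coextension_isScalarTower

/-- Coextension of scalars preserves injectivity. -/
lemma injective_coextension (E : Type u) [AddCommGroup E] [Module R E] [Module.Injective R E] :
    Module.Injective S (S →ₗ[R] E) where
  out X Y _ _ _ _ f hf g := by
    let _ : Module R X := Module.compHom X (algebraMap R S)
    let _ : Module R Y := Module.compHom Y (algebraMap R S)
    have : IsScalarTower R S X := .of_algebraMap_smul fun _ _ => rfl
    have : IsScalarTower R S Y := .of_algebraMap_smul fun _ _ => rfl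
    let g₀ : X →ₗ[R] E := (LinearMap.applyₗ (1 : S)) ∘ₗ g.restrictScalars R
    obtain ⟨h₀, hh⟩ := Module.Injective.extension_property R E _ _ (f.restrictScalars R) hf g₀
    refine ⟨⟨⟨fun y => h₀ ∘ₗ (LinearMap.toSpanSingleton S Y y).restrictScalars R, ?_⟩, ?_⟩, ?_⟩
    · intro y z
      ext t
      simp
    · intro s y
      ext t
      rw [RingHom.id_apply, coextension_smul_apply]
      simp [mul_smul]
    · intro x
      ext t
      have := LinearMap.congr_fun hh (t • x)
      simp only [LinearMap.comp_apply, LinearMap.restrictScalars_apply, map_smul, g₀,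
        LinearMap.applyₗ_apply_apply, coextension_smul_apply, one_mul] at this
      simpa using this

/-- Over a finite extension of fields, `Hom_k(l, k)` is a free `l`-module on any nonzero
functional. -/
lemma exists_eq_functional_comp_mul {k l : Type*} [Field k] [Field l] [Algebra k l]
    [FiniteDimensional k l] {φ : l →ₗ[k] k} (hφ : φ ≠ 0) (μ : l →ₗ[k] k) :
    ∃ a : l, ∀ t, μ t = φ (t * a) := by
  let Λ : l →ₗ[k] (l →ₗ[k] k) :=
    { toFun := fun a => φ ∘ₗ LinearMap.mulRight k a
      map_add' := fun a b => by ext t; simp [mul_add]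
      map_smul' := fun c a => by ext t; simp }
  have hΛ : Function.Injective Λ := by
    rw [injective_iff_map_eq_zero]
    intro a ha
    by_contra h0
    refine hφ (LinearMap.ext fun t => ?_)
    have := LinearMap.congr_fun ha (t * a⁻¹)
    simpa [Λ, mul_assoc, h0] using this
  obtain ⟨a, ha⟩ := (LinearMap.injective_iff_surjective_of_finrank_eq_finrank
    (Subspace.dual_finrank_eq (K := k) (V := l)).symm).1 hΛ μ
  exact ⟨a, fun t => by rw [← ha]; rfl⟩

variable [IsLocalRing R] [IsLocalRing S] [Module.Finite R S]
  {E : Type u} [AddCommGroup E] [Module R E]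

/-- Every nonzero submodule of `Hom_R(S, E)` contains a nonzero element of the socle. -/
lemma exists_mem_coextension_forall_smul_eq_zero [IsNoetherianRing R] [IsNoetherianRing S]
    (hE : IsInjectiveHullResidueField R E) {N : Submodule S (S →ₗ[R] E)} (hN : N ≠ ⊥) :
    ∃ g ∈ N, g ≠ 0 ∧ ∀ a ∈ maximalIdeal S, a • g = 0 := by
  obtain ⟨f, hfN, hf0⟩ := Submodule.exists_mem_ne_zero_of_ne_bot hN
  have : Nontrivial N := ⟨⟨f, hfN⟩, 0, fun h => hf0 (congrArg Subtype.val h)⟩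
  obtain ⟨P, hP⟩ := associatedPrimes.nonempty S N
  rw [AssociatedPrimes.mem_iff, isAssociatedPrime_iff] at hP
  obtain ⟨hP, ⟨g, hgN⟩, rfl⟩ := hP
  set P := (⊥ : Submodule S N).colon {⟨g, hgN⟩} with hPdef
  have hmem (a : S) : a ∈ P ↔ a • g = 0 := by
    rw [hPdef, Submodule.mem_colon_singleton, Submodule.mem_bot, ← Subtype.coe_inj]
    rfl
  have hcomap : P.comap (algebraMap R S) = maximalIdeal R := by
    refine le_antisymm (le_maximalIdeal (Ideal.IsPrime.under R P).ne_top) fun a ha => ?_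
    obtain ⟨T, hT⟩ := (Module.finite_def (R := R) (M := S)).1 inferInstance
    choose n hn using fun t : S => hE.exists_pow_smul_eq_zero ha (g t)
    have hg : a ^ (∑ t ∈ T, n t) • g = 0 := by
      refine LinearMap.ext_on hT fun t ht => ?_
      rw [LinearMap.smul_apply, ← Nat.sub_add_cancel
        (Finset.single_le_sum (f := n) (fun _ _ => Nat.zero_le _) ht), pow_add, mul_smul, hn t,
        smul_zero, LinearMap.zero_apply]
    refine hP.mem_of_pow_mem (∑ t ∈ T, n t) ?_
    rw [← map_pow, hmem, algebraMap_smul, hg]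
  have hmax : P.IsMaximal := Ideal.isMaximal_of_isIntegral_of_isMaximal_comap (R := R) P
    (hcomap ▸ maximalIdeal.isMaximal R)
  refine ⟨g, hgN, fun h0 => hP.ne_top ?_, fun a ha => ?_⟩
  · rw [Ideal.eq_top_iff_one, hmem, h0, smul_zero]
  · rw [← hmem, IsLocalRing.eq_maximalIdeal hmax]
    exact ha

/-- For a finite local homomorphism `R → S`, the coextension `Hom_R(S, E)` of the injective hull
of the residue field of `R` is the injective hull of the residue field of `S`. -/
theorem IsInjectiveHullResidueField.coextension [IsNoetherianRing R] [IsNoetherianRing S]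
    [IsLocalHom (algebraMap R S)]
    (hE : IsInjectiveHullResidueField R E) :
    IsInjectiveHullResidueField S (S →ₗ[R] E) := by
  have hE' := hE
  obtain ⟨hinj, ι, hι, hess⟩ := hE'
  refine ⟨injective_coextension E, ?_⟩
  -- A nonzero functional on the residue field of `S` generates the socle.
  obtain ⟨φ, hφ⟩ : ∃ φ : ResidueField S →ₗ[ResidueField R] ResidueField R, φ ≠ 0 := by
    by_contra! h
    exact one_ne_zero ((Module.forall_dual_apply_eq_zero_iff (ResidueField R)
      (1 : ResidueField S)).1 fun φ => by rw [h φ]; rfl)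
  let res : S →ₗ[R] ResidueField S := (IsScalarTower.toAlgHom R S (ResidueField S)).toLinearMap
  have hres (t : S) : res t = residue S t := rfl
  let ι' : ResidueField S →ₗ[S] (S →ₗ[R] E) :=
    { toFun := fun a => ι ∘ₗ (φ.restrictScalars R) ∘ₗ LinearMap.mulRight R a ∘ₗ res
      map_add' := fun a b => by
        ext t
        simp [mul_add]
      map_smul' := fun s a => by
        ext t
        simp only [RingHom.id_apply, coextension_smul_apply, LinearMap.comp_apply, hres,
          LinearMap.mulRight_apply, Algebra.smul_def, ResidueField.algebraMap_eq, map_mul,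
          mul_assoc] }
  have hι' (a : ResidueField S) (t : S) : ι' a t = ι (φ (residue S t * a)) := rfl
  refine ⟨ι', ?_, fun N hN => ?_⟩
  · rw [injective_iff_map_eq_zero]
    intro a ha
    by_contra h0
    refine hφ (LinearMap.ext fun y => ?_)
    obtain ⟨t, ht⟩ := residue_surjective (y * a⁻¹)
    have h1 := LinearMap.congr_fun ha t
    rw [hι', ht, inv_mul_cancel_right₀ h0, LinearMap.zero_apply, map_eq_zero_iff ι hι] at h1
    exact h1
  · obtain ⟨g, hgN, hg0, hg⟩ := exists_mem_coextension_forall_smul_eq_zero hE hN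
    have hg1 (a : S) (ha : a ∈ maximalIdeal S) : g a = 0 := by
      have := LinearMap.congr_fun (hg a ha) 1
      rwa [coextension_smul_apply, one_mul] at this
    have hrange (t : S) : g t ∈ LinearMap.range ι :=
      mem_range_of_forall_smul_eq_zero hess fun b hb => by
        rw [← map_smul, Algebra.smul_def]
        exact hg1 _ (Ideal.mul_mem_right _ _
          ((map_mem_nonunits_iff (algebraMap R S) b).2 hb))
    let μ₀ : ResidueField S →ₗ[R] ResidueField R :=
      (LinearEquiv.ofInjective ι hι).symm.toLinearMap ∘ₗ
        Submodule.liftQ ((maximalIdeal S).restrictScalars R) (g.codRestrict _ hrange)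
          (fun a ha => by
            rw [LinearMap.mem_ker]
            exact Subtype.ext (hg1 a ha))
    let μ : ResidueField S →ₗ[ResidueField R] ResidueField R :=
      μ₀.extendScalarsOfSurjective residue_surjective
    have hμ (t : S) : ι (μ (residue S t)) = g t :=
      congrArg Subtype.val ((LinearEquiv.ofInjective ι hι).apply_symm_apply ⟨g t, hrange t⟩)
    obtain ⟨a, ha⟩ := exists_eq_functional_comp_mul hφ μ
    refine (Submodule.ne_bot_iff _).2 ⟨g, ⟨hgN, a, ?_⟩, hg0⟩
    ext t
    rw [hι', ← ha, hμ]

/-- Injective hulls of the residue field are unique up to isomorphism. -/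
theorem IsInjectiveHullResidueField.nonempty_linearEquiv {R : Type u} [CommRing R] [IsLocalRing R]
    {E₁ E₂ : Type u} [AddCommGroup E₁] [Module R E₁] [AddCommGroup E₂] [Module R E₂]
    (h₁ : IsInjectiveHullResidueField R E₁) (h₂ : IsInjectiveHullResidueField R E₂) :
    Nonempty (E₁ ≃ₗ[R] E₂) := by
  obtain ⟨hinj₁, ι₁, hι₁, hess₁⟩ := h₁
  obtain ⟨hinj₂, ι₂, hι₂, hess₂⟩ := h₂
  obtain ⟨h, hh⟩ := Module.Injective.extension_property R E₂ _ _ ι₁ hι₁ ι₂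
  have hinj : Function.Injective h := by
    rw [← LinearMap.ker_eq_bot]
    by_contra hne
    refine hess₁ _ hne (eq_bot_iff.2 ?_)
    rintro _ ⟨hx, y, rfl⟩
    have h1 : ι₂ y = 0 := by rw [← hh]; exact hx
    rw [(map_eq_zero_iff ι₂ hι₂).1 h1, map_zero]
    exact Submodule.zero_mem _
  obtain ⟨r, hr⟩ := Module.Injective.extension_property R E₁ _ _ h hinj LinearMap.id
  have hrinj : Function.Injective r := by
    rw [← LinearMap.ker_eq_bot]
    by_contra hne
    refine hess₂ _ hne (eq_bot_iff.2 ?_)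
    rintro _ ⟨hx, y, rfl⟩
    have h1 : ι₁ y = 0 := by
      rw [← hh] at hx
      have := LinearMap.congr_fun hr (ι₁ y)
      exact this.symm.trans hx
    rw [(map_eq_zero_iff ι₁ hι₁).1 h1, map_zero]
    exact Submodule.zero_mem _
  refine ⟨LinearEquiv.ofBijective h ⟨hinj, fun y => ⟨r y, hrinj ?_⟩⟩⟩
  exact LinearMap.congr_fun hr (r y)

end Coextension

/-! ### Tensor products and duals of homomorphism modules -/

section HomTensor

open TensorProduct

variable {R : Type u} [CommRing R] (X W : Type*) (E : Type u) [AddCommGroup X]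
  [AddCommGroup W] [AddCommGroup E] [Module R X] [Module R W] [Module R E]

/-- The canonical map `X ⊗ Hom(W, E) → Hom(Hom(X, W), E)`. -/
def tensorHomToDualHom : X ⊗[R] (W →ₗ[R] E) →ₗ[R] ((X →ₗ[R] W) →ₗ[R] E) :=
  TensorProduct.lift (LinearMap.mk₂ R (fun x g => g ∘ₗ LinearMap.applyₗ x)
    (fun x y g => by ext h; simp) (fun r x g => by ext h; simp)
    (fun x g g' => by ext h; simp) (fun r x g => by ext h; simp))

lemma tensorHomToDualHom_tmul (x : X) (g : W →ₗ[R] E) (h : X →ₗ[R] W) :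
    tensorHomToDualHom X W E (x ⊗ₜ g) h = g (h x) := rfl

variable {X} in
/-- The canonical map `X ⊗ Hom(W, E) → Hom(Hom(X, W), E)` is natural in `X`. -/
lemma lcomp_lcomp_tensorHomToDualHom {Y : Type*} [AddCommGroup Y] [Module R Y] (g : X →ₗ[R] Y)
    (z : X ⊗[R] (W →ₗ[R] E)) :
    LinearMap.lcomp R E (LinearMap.lcomp R W g) (tensorHomToDualHom X W E z) =
      tensorHomToDualHom Y W E (g.rTensor _ z) := by
  induction z with
  | zero => simp
  | tmul y w => rfl
  | add x y hx hy => simp only [map_add, hx, hy]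

lemma bijective_tensorHomToDualHom_pi (n : ℕ) :
    Function.Bijective (tensorHomToDualHom (R := R) (Fin n → R) W E) := by
  classical
  let h (i : Fin n) (w : W) : (Fin n → R) →ₗ[R] W :=
    (LinearMap.toSpanSingleton R W w) ∘ₗ LinearMap.proj i
  have hsum (z : (Fin n → R) ⊗[R] (W →ₗ[R] E)) : ∃ g : Fin n → (W →ₗ[R] E),
      z = ∑ i, Pi.single i (1 : R) ⊗ₜ g i := by
    induction z with
    | zero => exact ⟨0, by simp⟩
    | tmul v g =>
      refine ⟨fun i => v i • g, ?_⟩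
      conv_lhs => rw [pi_eq_sum_univ' v]
      simp only [TensorProduct.sum_tmul, TensorProduct.smul_tmul]
    | add a b ha hb =>
      obtain ⟨g, rfl⟩ := ha
      obtain ⟨g', rfl⟩ := hb
      exact ⟨g + g', by simp [TensorProduct.tmul_add, Finset.sum_add_distrib]⟩
  constructor
  · rw [injective_iff_map_eq_zero]
    intro z hz
    obtain ⟨g, rfl⟩ := hsum z
    have hg (j) : g j = 0 := by
      ext w
      have h1 := LinearMap.congr_fun hz (h j w)
      rw [map_sum, LinearMap.sum_apply, Finset.sum_eq_single j] at h1
      · simpa [tensorHomToDualHom_tmul, h] using h1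
      · intro i _ hij
        simp [tensorHomToDualHom_tmul, h, hij.symm]
      · simp
    simp [hg]
  · intro Ψ
    let hl (i : Fin n) : W →ₗ[R] ((Fin n → R) →ₗ[R] W) :=
      { toFun := h i
        map_add' := fun a b => by ext; simp [h]
        map_smul' := fun r a => LinearMap.ext fun v => smul_comm (v i) r a }
    refine ⟨∑ i, Pi.single i (1 : R) ⊗ₜ[R] (Ψ ∘ₗ hl i), LinearMap.ext fun f => ?_⟩
    simp only [map_sum, LinearMap.sum_apply, tensorHomToDualHom_tmul, LinearMap.comp_apply]
    rw [← map_sum]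
    congr 1
    refine LinearMap.pi_ext' fun i => LinearMap.ext_ring ?_
    rw [LinearMap.comp_apply, LinearMap.sum_apply, Finset.sum_eq_single i]
    · simp [hl, h]
    · intro j _ hij
      simp [hl, h, hij]
    · simp

/-- For `X` finitely presented and `E` injective, the canonical map
`X ⊗ Hom(W, E) → Hom(Hom(X, W), E)` is bijective: both sides are right exact in `X`. -/
theorem bijective_tensorHomToDualHom [IsNoetherianRing R] [Module.Finite R X]
    [Module.Injective R E] : Function.Bijective (tensorHomToDualHom (R := R) X W E) := by
  obtain ⟨b, π, hπ⟩ := Module.Finite.exists_fin' R X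
  obtain ⟨a, ρ, hρ⟩ := Module.Finite.exists_fin' R (LinearMap.ker π)
  let f : (Fin a → R) →ₗ[R] (Fin b → R) := (LinearMap.ker π).subtype ∘ₗ ρ
  have hf : Function.Exact f π := by
    rw [LinearMap.exact_iff, LinearMap.range_comp, LinearMap.range_eq_top.2 hρ,
      Submodule.map_subtype_top]
  have hexact := Module.Injective.exact_lcomp E
    (LinearMap.exact_lcomp_of_exact_of_surjective W hf hπ)
  have hsurj : Function.Surjective (LinearMap.lcomp R E (LinearMap.lcomp R W π)) := fun Ψ =>
    Module.Injective.extension_property R E _ _ _ (LinearMap.lcomp_injective_of_surjective π hπ) Ψ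
  constructor
  · rw [injective_iff_map_eq_zero]
    intro z hz
    obtain ⟨y, rfl⟩ := LinearMap.rTensor_surjective _ hπ z
    rw [← lcomp_lcomp_tensorHomToDualHom] at hz
    obtain ⟨v, hv⟩ := (hexact _).1 hz
    obtain ⟨w, rfl⟩ := (bijective_tensorHomToDualHom_pi W E a).2 v
    rw [lcomp_lcomp_tensorHomToDualHom] at hv
    rw [← (bijective_tensorHomToDualHom_pi W E b).1 hv]
    exact (rTensor_exact _ hf hπ).apply_apply_eq_zero w
  · intro Ψ
    obtain ⟨Φ, rfl⟩ := hsurj Ψ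
    obtain ⟨y, rfl⟩ := (bijective_tensorHomToDualHom_pi W E b).2 Φ
    exact ⟨_, (lcomp_lcomp_tensorHomToDualHom W E π y).symm⟩

end HomTensor

section

open TensorProduct IsLocalRing

variable {R S : Type u} [CommRing R] [CommRing S] [Algebra R S]

attribute [local instance] coextensionModule coextension_isScalarTower

/-- The canonical map `S ⊗ Hom_R(W, E) → Hom_S(Hom_R(S, W), Hom_R(S, E))`. -/
def tensorHomToCoextensionHom (S W E : Type u) [CommRing S] [Algebra R S] [AddCommGroup W]
    [AddCommGroup E] [Module R W] [Module R E] :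
    S ⊗[R] (W →ₗ[R] E) →ₗ[S] ((S →ₗ[R] W) →ₗ[S] (S →ₗ[R] E)) :=
  LinearMap.liftBaseChange S
    { toFun := fun g =>
        { toFun := fun h => g ∘ₗ h
          map_add' := fun h h' => LinearMap.comp_add _ _ _
          map_smul' := fun s h => rfl }
      map_add' := fun g g' => rfl
      map_smul' := fun r g => by
        ext h t
        rfl }

theorem bijective_tensorHomToCoextensionHom [IsNoetherianRing R] [Module.Finite R S]
    (W E : Type u) [AddCommGroup W] [AddCommGroup E] [Module R W] [Module R E]
    [Module.Injective R E] :
    Function.Bijective (tensorHomToCoextensionHom (R := R) S W E) := by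
  -- Evaluation at `1 : S` identifies the target with the dual of `Hom_R(S, W)`.
  let ev (Φ : (S →ₗ[R] W) →ₗ[S] (S →ₗ[R] E)) : (S →ₗ[R] W) →ₗ[R] E :=
    LinearMap.applyₗ (1 : S) ∘ₗ Φ.restrictScalars R
  have hev : Function.Injective ev := by
    intro Φ Ψ h
    ext f t
    have := LinearMap.congr_fun h (t • f)
    simpa [ev, coextension_smul_apply] using this
  have hcomp : ev ∘ tensorHomToCoextensionHom (R := R) S W E = tensorHomToDualHom S W E := by
    funext z
    induction z with
    | zero => ext; simp [ev]
    | tmul s g =>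
      ext h
      simp only [Function.comp, ev, tensorHomToCoextensionHom, tensorHomToDualHom_tmul,
        LinearMap.comp_apply, LinearMap.restrictScalars_apply, LinearMap.liftBaseChange_tmul,
        LinearMap.applyₗ_apply_apply, LinearMap.smul_apply, coextension_smul_apply, one_mul]
      rfl
    | add a b ha hb =>
      simp only [map_add, ← ha, ← hb]
      ext h
      simp [ev]
  have hb := bijective_tensorHomToDualHom (R := R) S W E
  rw [← hcomp] at hb
  exact ⟨hb.1.of_comp, fun Φ => by
    obtain ⟨z, hz⟩ := hb.2 (ev Φ)
    exact ⟨z, hev hz⟩⟩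

end

/-! ### Top Čech cohomology and base change -/

section Cech

/-- A presentation of the top Čech cohomology of `x₁, …, x_d` as the direct limit of the modules
`S / (x₁ ^ k, …, x_d ^ k)` with transition maps given by multiplication by `∏ i, x i`; the element
`η k` is the class of `1 / (∏ i, x i) ^ k`. -/
structure IsTopCech {S : Type*} [CommRing S] {d : ℕ} (x : Fin d → S) {H : Type*} [AddCommGroup H]
    [Module S H] (η : ℕ → H) : Prop where
  smul_succ : ∀ k, (∏ i, x i) • η (k + 1) = η k
  exists_eq_smul : ∀ h, ∃ k, ∃ s : S, h = s • η k
  smul_eq_zero_iff : ∀ k (s : S), s • η k = 0 ↔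
    ∃ N, s * (∏ i, x i) ^ N ∈ Ideal.span (Set.range fun i => x i ^ (N + k))

lemma mem_span_range_pow_iff {S : Type*} [CommRing S] {d : ℕ} (x : Fin d → S) (n : ℕ) (s : S) :
    s ∈ Ideal.span (Set.range fun i => x i ^ n) ↔ ∃ a : Fin d → S, ∑ i, a i * x i ^ n = s :=
  Ideal.mem_span_range_iff_exists_fun

theorem isTopCech_topCechCohomology {R : Type*} [CommRing R] {d : ℕ} (x : Fin d → R) :
    IsTopCech x (fun k => (Submodule.Quotient.mk (IsLocalization.mk' (Localization.Away (∏ j, x j))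
      (1 : R) (⟨(∏ j, x j) ^ k, k, rfl⟩ : Submonoid.powers (∏ j, x j))) :
        TopCechCohomology x)) := by
  set Y := ∏ j, x j with hY
  let pw (k : ℕ) : Submonoid.powers Y := ⟨Y ^ k, k, rfl⟩
  let y (i : Fin d) := ∏ j ∈ Finset.univ.erase i, x j
  let pwi (i : Fin d) (k : ℕ) : Submonoid.powers (y i) := ⟨y i ^ k, k, rfl⟩
  have hyi (i : Fin d) : x i * y i = Y := Finset.mul_prod_erase _ _ (Finset.mem_univ i)
  have hcech (i : Fin d) (a : R) (l : ℕ) :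
      cechMap x i (IsLocalization.mk' _ a (pwi i l)) =
        IsLocalization.mk' (Localization.Away Y) (a * x i ^ l) (pw l) := by
    rw [IsLocalization.eq_mk'_iff_mul_eq]
    have h1 : (IsLocalization.mk' (Localization.Away (y i)) a (pwi i l)) *
        algebraMap R _ (y i ^ l) = algebraMap R _ a := IsLocalization.mk'_spec _ a (pwi i l)
    have h2 := congrArg (cechMap x i) h1
    rw [map_mul, AlgHom.commutes, AlgHom.commutes] at h2
    rw [map_mul, ← h2, mul_assoc, ← map_mul, ← mul_pow, mul_comm (y i), hyi]
  refine ⟨fun k => ?_, fun h => ?_, fun k s => ?_⟩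
  · rw [← Submodule.Quotient.mk_smul]
    congr 1
    rw [Algebra.smul_def, IsLocalization.mul_mk'_eq_mk'_of_mul, mul_one,
      IsLocalization.mk'_eq_iff_eq]
    simp [pow_succ, mul_comm]
  · obtain ⟨z, rfl⟩ := Submodule.Quotient.mk_surjective _ h
    obtain ⟨s, ⟨_, k, rfl⟩, rfl⟩ := IsLocalization.exists_mk'_eq (Submonoid.powers Y) z
    refine ⟨k, s, ?_⟩
    rw [← Submodule.Quotient.mk_smul]
    congr 1
    rw [Algebra.smul_def, IsLocalization.mul_mk'_eq_mk'_of_mul, mul_one]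
  · rw [← Submodule.Quotient.mk_smul, Algebra.smul_def, IsLocalization.mul_mk'_eq_mk'_of_mul,
      mul_one, Submodule.Quotient.mk_eq_zero]
    constructor
    · intro h
      obtain ⟨f, hf, hsum⟩ := (Submodule.mem_iSup_iff_exists_finsupp _ _).1 h
      choose v hv using hf
      choose a l hal using fun i => IsLocalization.exists_mk'_eq (Submonoid.powers (y i)) (v i)
      choose m hm using fun i => (l i).2
      let n := ∑ i, m i
      have hmn (i : Fin d) : m i + (n - m i) = n :=
        Nat.add_sub_of_le (Finset.single_le_sum (fun _ _ => Nat.zero_le _) (Finset.mem_univ i))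
      -- After multiplication by `Y ^ n` every summand is an element of `R` divisible by `x i ^ n`.
      have hfn (i : Fin d) : f i * algebraMap R _ (Y ^ n) =
          algebraMap R (Localization.Away Y) (a i * y i ^ (n - m i) * x i ^ n) := by
        have h1 : l i = pwi i (m i) := Subtype.ext (hm i).symm
        rw [← hv i, AlgHom.toLinearMap_apply, ← hal i, h1, hcech]
        have h2 : Y ^ n = (pw (m i) : R) * (x i * y i) ^ (n - m i) := by
          rw [hyi]
          change Y ^ n = Y ^ m i * _
          rw [← pow_add, hmn]
        rw [h2, map_mul, ← mul_assoc, IsLocalization.mk'_spec, ← map_mul]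
        congr 1
        conv_rhs => rw [← hmn i, pow_add, Nat.add_sub_cancel_left]
        ring
      have h1 : algebraMap R (Localization.Away Y) (s * Y ^ n) =
          algebraMap R _ ((∑ i, a i * y i ^ (n - m i) * x i ^ n) * Y ^ k) := by
        rw [map_mul, ← IsLocalization.mk'_spec (Localization.Away Y) s (pw k), ← hsum,
          Finsupp.sum_fintype _ _ (fun _ => rfl), mul_right_comm, Finset.sum_mul, map_mul, map_sum]
        simp_rw [← hfn]
        rfl
      obtain ⟨⟨_, t, rfl⟩, ht⟩ := (IsLocalization.eq_iff_exists (Submonoid.powers Y) _).1 h1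
      refine ⟨t + n, (mem_span_range_pow_iff _ _ _).2
        ⟨fun i => a i * y i ^ (n - m i) * y i ^ (t + k), ?_⟩⟩
      have h2 : s * Y ^ (t + n) = Y ^ t * (s * Y ^ n) := by ring
      rw [h2, ht, Finset.sum_mul, Finset.mul_sum]
      refine Finset.sum_congr rfl fun i _ => ?_
      rw [← hyi i]
      ring
    · rintro ⟨N, hN⟩
      obtain ⟨a, ha⟩ := (mem_span_range_pow_iff _ _ _).1 hN
      have h1 : IsLocalization.mk' (Localization.Away Y) s (pw k) =
          ∑ i, cechMap x i (IsLocalization.mk' _ (a i) (pwi i (N + k))) := by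
        have hu : IsUnit (algebraMap R (Localization.Away Y) (Y ^ (N + k))) :=
          IsLocalization.map_units _ (pw (N + k))
        have h2 (i : Fin d) : IsLocalization.mk' (Localization.Away Y) (a i * x i ^ (N + k))
          (pw (N + k)) * algebraMap R _ (Y ^ (N + k)) = algebraMap R _ (a i * x i ^ (N + k)) :=
            IsLocalization.mk'_spec _ _ (pw (N + k))
        refine hu.mul_left_injective ?_
        simp only [hcech, Finset.sum_mul, h2]
        rw [← map_sum, ha, pow_add, mul_comm (Y ^ N), map_mul, map_mul, ← mul_assoc]
        congr 1
        exact IsLocalization.mk'_spec _ _ (pw k)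
      rw [h1]
      exact Submodule.sum_mem _ fun i _ => Submodule.mem_iSup_of_mem i ⟨_, rfl⟩

lemma IsTopCech.smul_add {S : Type*} [CommRing S] {d : ℕ} {x : Fin d → S} {H : Type*}
    [AddCommGroup H] [Module S H] {η : ℕ → H} (h : IsTopCech x η) (k l : ℕ) :
    (∏ i, x i) ^ l • η (k + l) = η k := by
  induction l with
  | zero => simp
  | succ l ih => rw [pow_succ, mul_smul, ← add_assoc, h.smul_succ, ih]

/-- The top Čech cohomology of the powers `x₁ ^ q, …, x_d ^ q` is that of `x₁, …, x_d`. -/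
lemma IsTopCech.pow {S : Type*} [CommRing S] {d : ℕ} {x : Fin d → S} {H : Type*}
    [AddCommGroup H] [Module S H] {η : ℕ → H} (h : IsTopCech x η) {q : ℕ} (hq : q ≠ 0) :
    IsTopCech (fun i => x i ^ q) (fun k => η (q * k)) where
  smul_succ k := by
    rw [Finset.prod_pow, Nat.mul_succ, h.smul_add]
  exists_eq_smul z := by
    obtain ⟨k, s, rfl⟩ := h.exists_eq_smul z
    refine ⟨k, s * (∏ i, x i) ^ (q * k - k), ?_⟩
    rw [mul_smul]
    conv_rhs => rw [← Nat.add_sub_of_le (Nat.le_mul_of_pos_left k (Nat.pos_of_ne_zero hq)),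
      Nat.add_sub_cancel_left, h.smul_add]
  smul_eq_zero_iff k s := by
    rw [h.smul_eq_zero_iff, Finset.prod_pow]
    simp only [← pow_mul, mem_span_range_pow_iff, Nat.mul_add]
    constructor
    · rintro ⟨N, a, ha⟩
      refine ⟨N, fun i => a i * (∏ j ∈ Finset.univ.erase i, x j) ^ (q * N - N), ?_⟩
      have hN : N + (q * N - N) = q * N :=
        Nat.add_sub_of_le (Nat.le_mul_of_pos_left N (Nat.pos_of_ne_zero hq))
      conv_rhs => rw [← hN, pow_add, ← mul_assoc, ← ha, Finset.sum_mul]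
      refine Finset.sum_congr rfl fun i _ => ?_
      conv_lhs => rw [← hN, Nat.add_sub_cancel_left]
      rw [← Finset.mul_prod_erase _ _ (Finset.mem_univ i)]
      ring
    · rintro ⟨N, a, ha⟩
      exact ⟨q * N, a, ha⟩

open TensorProduct in
/-- Top Čech cohomology commutes with base change. -/
theorem IsTopCech.nonempty_baseChange_equiv {R S : Type*} [CommRing R] [CommRing S] [Algebra R S]
    {d : ℕ} {x : Fin d → R} {H H' : Type*} [AddCommGroup H] [Module R H] [AddCommGroup H']
    [Module S H'] {η : ℕ → H} {η' : ℕ → H'} (h : IsTopCech x η)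
    (h' : IsTopCech (fun i => algebraMap R S (x i)) η') : Nonempty (S ⊗[R] H ≃ₗ[S] H') := by
  let _ : Module R H' := Module.compHom H' (algebraMap R S)
  have : IsScalarTower R S H' := .of_algebraMap_smul fun _ _ => rfl
  have hx : ∏ i, algebraMap R S (x i) = algebraMap R S (∏ i, x i) := (map_prod _ _ _).symm
  have hadd (k l : ℕ) : (∏ i, x i) ^ l • η' (k + l) = η' k := by
    rw [← h'.smul_add k l, hx, ← map_pow, algebraMap_smul]
  have hzero (k : ℕ) (r : R) (hr : r • η k = 0) : r • η' k = 0 := by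
    rw [← algebraMap_smul S, h'.smul_eq_zero_iff]
    obtain ⟨N, hN⟩ := (h.smul_eq_zero_iff k r).1 hr
    obtain ⟨a, ha⟩ := (mem_span_range_pow_iff _ _ _).1 hN
    refine ⟨N, (mem_span_range_pow_iff _ _ _).2 ⟨fun i => algebraMap R S (a i), ?_⟩⟩
    rw [hx, ← map_pow, ← map_mul, ← ha]
    simp
  have hwd (k l : ℕ) (r s : R) (hrs : r • η k = s • η l) : r • η' k = s • η' l := by
    rw [← hadd k l, ← hadd l k, add_comm l k, smul_smul, smul_smul, ← sub_eq_zero, ← sub_smul]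
    refine hzero _ _ ?_
    rw [sub_smul, mul_smul, mul_smul, h.smul_add, add_comm k l, h.smul_add, hrs, sub_self]
  -- The map sending `r • η k` to `r • η' k` is well defined by `hwd`.
  choose κ ρ hκ using h.exists_eq_smul
  have hf (k : ℕ) (r : R) : ρ (r • η k) • η' (κ (r • η k)) = r • η' k :=
    hwd _ _ _ _ (hκ _).symm
  let f : H →ₗ[R] H' :=
    { toFun := fun z => ρ z • η' (κ z)
      map_add' := fun y z => by
        obtain ⟨k, r, rfl⟩ := h.exists_eq_smul y
        obtain ⟨l, s, rfl⟩ := h.exists_eq_smul z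
        rw [hf, hf]
        have h1 : r • η k + s • η l =
            (r * (∏ i, x i) ^ l + s * (∏ i, x i) ^ k) • η (k + l) := by
          rw [add_smul, mul_smul, mul_smul, h.smul_add, add_comm k l, h.smul_add]
        rw [h1, hf, add_smul, mul_smul, mul_smul, hadd, add_comm k l, hadd]
      map_smul' := fun r z => by
        obtain ⟨k, s, rfl⟩ := h.exists_eq_smul z
        rw [smul_smul, hf, hf, mul_smul, RingHom.id_apply] }
  have hfη (k : ℕ) : f (η k) = η' k := by
    have := hf k 1
    rwa [one_smul, one_smul] at this
  have hform (z : S ⊗[R] H) : ∃ k, ∃ s : S, z = s ⊗ₜ η k := by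
    induction z with
    | zero => exact ⟨0, 0, by simp⟩
    | tmul s z =>
      obtain ⟨k, r, rfl⟩ := h.exists_eq_smul z
      exact ⟨k, r • s, by rw [TensorProduct.smul_tmul]⟩
    | add y z hy hz =>
      obtain ⟨k, r, rfl⟩ := hy
      obtain ⟨l, s, rfl⟩ := hz
      refine ⟨k + l, (∏ i, x i) ^ l • r + (∏ i, x i) ^ k • s, ?_⟩
      rw [TensorProduct.add_tmul, TensorProduct.smul_tmul, TensorProduct.smul_tmul, h.smul_add,
        add_comm k l, h.smul_add]
  refine ⟨LinearEquiv.ofBijective (f.liftBaseChange S) ⟨?_, fun z => ?_⟩⟩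
  · rw [injective_iff_map_eq_zero]
    intro z hz
    obtain ⟨k, s, rfl⟩ := hform z
    rw [LinearMap.liftBaseChange_tmul, hfη, h'.smul_eq_zero_iff] at hz
    obtain ⟨N, hN⟩ := hz
    obtain ⟨a, ha⟩ := (mem_span_range_pow_iff _ _ _).1 hN
    have hk (i : Fin d) : x i ^ (N + k) • η (k + N) = 0 := by
      rw [h.smul_eq_zero_iff]
      refine ⟨0, ?_⟩
      rw [pow_zero, mul_one, zero_add, add_comm]
      exact Ideal.subset_span ⟨i, rfl⟩
    have h1 : s ⊗ₜ[R] η k = (s * algebraMap R S ((∏ i, x i) ^ N)) ⊗ₜ[R] η (k + N) := by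
      rw [mul_comm, ← Algebra.smul_def, TensorProduct.smul_tmul, h.smul_add]
    rw [h1, map_pow, ← hx, ← ha, TensorProduct.sum_tmul]
    refine Finset.sum_eq_zero fun i _ => ?_
    rw [← map_pow, mul_comm, ← Algebra.smul_def, TensorProduct.smul_tmul, hk,
      TensorProduct.tmul_zero]
  · obtain ⟨k, s, rfl⟩ := h'.exists_eq_smul z
    exact ⟨s ⊗ₜ η k, by rw [LinearMap.liftBaseChange_tmul, hfη]⟩

end Cech

/-! ### Duality for a finite local homomorphism -/

section Duality

open TensorProduct IsLocalRing

attribute [local instance] coextensionModule coextension_isScalarTower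

/-- Duality for a finite local homomorphism `R → S`: if `ω` and `ω'` are finitely generated modules
over `R` and `S` that are dual to the top Čech cohomology of the same elements of `R`, then `ω'` is
the coextension `Hom_R(S, ω)`. -/
theorem nonempty_linearEquiv_coextension {R S : Type u} [CommRing R] [CommRing S] [Algebra R S]
    [IsLocalRing R] [IsLocalRing S] [IsNoetherianRing R] [IsNoetherianRing S]
    [IsLocalHom (algebraMap R S)] [Module.Finite R S]
    {ω E H : Type u} [AddCommGroup ω] [Module R ω] [AddCommGroup E] [Module R E] [AddCommGroup H]
    [Module R H] {ω' E' H' : Type u} [AddCommGroup ω'] [Module S ω'] [AddCommGroup E']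
    [Module S E'] [AddCommGroup H'] [Module S H'] [Module.Finite R ω] [Module.Finite S ω']
    (hE : IsInjectiveHullResidueField R E) (hE' : IsInjectiveHullResidueField S E')
    {d : ℕ} {x : Fin d → R} {η : ℕ → H} {η' : ℕ → H'} (hη : IsTopCech x η)
    (hη' : IsTopCech (fun i => algebraMap R S (x i)) η')
    (e : (ω →ₗ[R] E) ≃ₗ[R] H) (e' : (ω' →ₗ[S] E') ≃ₗ[S] H') :
    Nonempty (ω' ≃ₗ[S] (S →ₗ[R] ω)) := by
  have := hE.1
  obtain ⟨ε⟩ := hE'.nonempty_linearEquiv (hE.coextension (S := S))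
  obtain ⟨β⟩ := hη.nonempty_baseChange_equiv hη'
  have hfin : Module.Finite R (S →ₗ[R] ω) := by
    obtain ⟨n, π, hπ⟩ := Module.Finite.exists_fin' R S
    exact Module.Finite.of_injective (LinearMap.lcomp R ω π)
      (LinearMap.lcomp_injective_of_surjective π hπ)
  have hfin' : Module.Finite S (S →ₗ[R] ω) := Module.Finite.of_restrictScalars_finite R _ _
  let θ := LinearEquiv.ofBijective _ (bijective_tensorHomToCoextensionHom (R := R) (S := S) ω E)
  refine (hE.coextension (S := S)).nonempty_linearEquiv_of_dual_of_finite _ _ ?_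
  exact (LinearEquiv.congrRight ε).symm.trans
    (e'.trans (β.symm.trans ((LinearEquiv.baseChange R S _ _ e.symm).trans θ)))

end Duality

/-! ### Frobenius pushforward -/

/-- The Frobenius pushforward `F^e_* M` of a module `M`: the same abelian group `M`. For a ring `R`
of characteristic `p`, the ring `F^e_* R` is `R` regarded as an `R`-algebra through the `e`-th
iterate of the Frobenius map, and `F^e_* M` is regarded as a module over `F^e_* R` only. -/
def FrobeniusPushforward (_p _e : ℕ) (M : Type*) : Type _ := M

namespace FrobeniusPushforward

section

variable (p e : ℕ) (R M : Type*) [CommRing R] [AddCommGroup M] [Module R M]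

instance : CommRing (FrobeniusPushforward p e R) := inferInstanceAs (CommRing R)

instance [IsLocalRing R] : IsLocalRing (FrobeniusPushforward p e R) :=
  inferInstanceAs (IsLocalRing R)

instance [IsNoetherianRing R] : IsNoetherianRing (FrobeniusPushforward p e R) :=
  inferInstanceAs (IsNoetherianRing R)

/-- The additive group of `F^e_* M`. -/
@[reducible]
def addCommGroup : AddCommGroup (FrobeniusPushforward p e M) := inferInstanceAs (AddCommGroup M)

attribute [local instance] addCommGroup

/-- The module structure of `F^e_* M` over `F^e_* R`. -/
@[reducible]
def module : Module (FrobeniusPushforward p e R) (FrobeniusPushforward p e M) :=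
  inferInstanceAs (Module R M)

variable [Fact p.Prime] [CharP R p]

instance : Algebra R (FrobeniusPushforward p e R) := (iterateFrobenius R p e).toAlgebra

instance : IsLocalHom (algebraMap R (FrobeniusPushforward p e R)) where
  map_nonunit _ ha := (isUnit_pow_iff (pow_ne_zero e (Fact.out : p.Prime).ne_zero)).1 ha

lemma finite (hF : (frobenius R p).Finite) : Module.Finite R (FrobeniusPushforward p e R) := by
  change (iterateFrobenius R p e).Finite
  induction e with
  | zero => rw [iterateFrobenius_zero]; exact RingHom.Finite.id R
  | succ e ih =>
    have : iterateFrobenius R p (e + 1) = (frobenius R p).comp (iterateFrobenius R p e) := by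
      ext r
      simp [iterateFrobenius_def, frobenius_def, pow_succ, pow_mul]
    rw [this]
    exact hF.comp ih

end

end FrobeniusPushforward

/-! ### The canonical module and Frobenius -/

section Canonical

open FrobeniusPushforward

attribute [local instance] addCommGroup module coextensionModule coextension_isScalarTower

/-- The duality `F_* ω ≅ Hom_R(F_* R, ω)` for a canonical module `ω`, in terms of Frobenius-inverse
linear maps `R → ω`. -/
theorem IsCanonicalModule.exists_frobenius_duality {R : Type u} [CommRing R] [IsLocalRing R]
    [IsNoetherianRing R] (p : ℕ) [Fact p.Prime] [CharP R p] (hF : (frobenius R p).Finite)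
    {ω : Type u} [AddCommGroup ω] [Module R ω] (hω : IsCanonicalModule R ω) :
    ∃ Ψ : ω →+ (R →+ ω), Function.Injective Ψ ∧
      (∀ w r s, Ψ w (r ^ p * s) = r • Ψ w s) ∧
      (∀ s w t, Ψ (s • w) t = Ψ w (t * s)) ∧
      ∀ h : R →+ ω, (∀ r s, h (r ^ p * s) = r • h s) → ∃ w, Ψ w = h := by
  obtain ⟨hfin, d, x, -, E, _, _, hE, ⟨e⟩⟩ := hω
  have hS := FrobeniusPushforward.finite p 1 R hF
  have hfin' : Module.Finite (FrobeniusPushforward p 1 R) (FrobeniusPushforward p 1 ω) := hfin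
  -- Over `F_* R` the sequence `x` becomes `x ^ p`, whose Čech cohomology is that of `x` again, so
  -- that `F_* ω` is a canonical module of `F_* R`.
  have hη := isTopCech_topCechCohomology x
  obtain ⟨Ψ⟩ : Nonempty (FrobeniusPushforward p 1 ω ≃ₗ[FrobeniusPushforward p 1 R]
      (FrobeniusPushforward p 1 R →ₗ[R] ω)) :=
    nonempty_linearEquiv_coextension (ω' := FrobeniusPushforward p 1 ω)
      (E' := FrobeniusPushforward p 1 E) (H' := FrobeniusPushforward p 1 (TopCechCohomology x))
      hE hE hη (hη.pow (pow_ne_zero 1 (Fact.out : p.Prime).ne_zero)) e e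
  let A (h : FrobeniusPushforward p 1 R →ₗ[R] ω) : R →+ ω := h.toAddMonoidHom
  have hA (h : FrobeniusPushforward p 1 R →ₗ[R] ω) (r s : R) : A h (r ^ p * s) = r • A h s := by
    have h1 : A h (r ^ p ^ 1 * s) = r • A h s := h.map_smul r s
    rwa [pow_one] at h1
  let Ψ' : ω →+ (R →+ ω) :=
    { toFun := fun w => A (Ψ w)
      map_zero' := congrArg A (map_zero Ψ)
      map_add' := fun w w' => congrArg A (map_add Ψ w w') }
  refine ⟨Ψ', fun w w' h => Ψ.injective ?_, fun w => hA _, fun s w t => ?_, fun h hh => ?_⟩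
  · ext t
    exact DFunLike.congr_fun h t
  · exact LinearMap.congr_fun (Ψ.map_smul s w) t
  · let g : FrobeniusPushforward p 1 R →ₗ[R] ω :=
      { toFun := h
        map_add' := h.map_add
        map_smul' := fun r s => by
          have := hh r s
          rwa [← pow_one p] at this }
    refine ⟨Ψ.symm g, ?_⟩
    change A (Ψ (Ψ.symm g)) = h
    rw [LinearEquiv.apply_symm_apply]
    rfl

end Canonical

/-! ### Orders of vanishing on a Noetherian normal domain -/

namespace PrimeDivisor

lemma not_le_of_ne {R : Type*} [CommRing R] [IsNoetherianRing R] {P Q : PrimeDivisor R}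
    (h : Q ≠ P) : ¬ Q.1.asIdeal ≤ P.1.asIdeal := by
  intro hle
  refine h (Subtype.ext (PrimeSpectrum.ext (hle.antisymm ?_)))
  by_contra hlt
  have h1 := Ideal.height_strict_mono_of_isPrime_of_isPrime (lt_of_le_not_ge hle hlt)
  rw [P.2, Q.2] at h1
  exact lt_irrefl _ h1

section Noetherian

variable {R : Type*} [CommRing R] [IsDomain R] [IsNoetherianRing R] (P : PrimeDivisor R)

lemma ord_inv (f : FractionRing R) : P.ord f⁻¹ = -P.ord f := by simp [ord, WithZero.log_inv]

lemma ord_pow (f : FractionRing R) (n : ℕ) : P.ord (f ^ n) = n * P.ord f := by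
  simp [ord, WithZero.log_pow]

lemma ord_zpow (f : FractionRing R) (n : ℤ) : P.ord (f ^ n) = n * P.ord f := by
  simp [ord, WithZero.log_zpow]

lemma ord_div {f g : FractionRing R} (hf : f ≠ 0) (hg : g ≠ 0) :
    P.ord (f / g) = P.ord f - P.ord g := by
  rw [div_eq_mul_inv, P.ord_mul hf (inv_ne_zero hg), ord_inv, sub_eq_add_neg]

lemma ord_algebraMap_localRing {v : P.LocalRing} (hv : v ≠ 0) :
    P.ord (algebraMap P.LocalRing (FractionRing R) v) = (Ring.ord P.LocalRing v).toNat := by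
  have hv' := mem_nonZeroDivisors_of_ne_zero hv
  rw [ord, Ring.ordFrac_eq_ord _ hv, Ring.ordMonoidWithZeroHom_eq_coe (n :=
    (Ring.ord P.LocalRing v).toNat) _ hv' (ENat.natCast_toNat (Ring.ord_ne_top hv')).symm]
  rfl

lemma ord_algebraMap_localRing_of_isUnit {v : P.LocalRing} (hv : IsUnit v) :
    P.ord (algebraMap P.LocalRing (FractionRing R) v) = 0 := by
  rw [ord_algebraMap_localRing P hv.ne_zero, Ring.ord_of_isUnit hv]
  rfl

lemma ord_algebraMap_localRing_pos {v : P.LocalRing} (hv0 : v ≠ 0) (hv : ¬ IsUnit v) :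
    1 ≤ P.ord (algebraMap P.LocalRing (FractionRing R) v) := by
  rw [ord_algebraMap_localRing P hv0]
  have hnt : Nontrivial (P.LocalRing ⧸ Ideal.span {v}) :=
    Ideal.Quotient.nontrivial_iff.2 fun h => hv (Ideal.span_singleton_eq_top.1 h)
  have h0 : Ring.ord P.LocalRing v ≠ 0 := (Module.length_pos (R := P.LocalRing)).ne'
  have h1 := Ring.ord_ne_top (mem_nonZeroDivisors_of_ne_zero hv0)
  have : (Ring.ord P.LocalRing v).toNat ≠ 0 := by simp [ENat.toNat_eq_zero, h0, h1]
  lia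

lemma one_le_ord_of_mem {r : R} (hr0 : r ≠ 0) (hr : r ∈ P.1.asIdeal) :
    1 ≤ P.ord (algebraMap R (FractionRing R) r) := by
  rw [IsScalarTower.algebraMap_apply R P.LocalRing]
  refine P.ord_algebraMap_localRing_pos ?_ fun h => ?_
  · exact (map_ne_zero_iff _ (IsLocalization.injective P.LocalRing
      P.1.asIdeal.primeCompl_le_nonZeroDivisors)).2 hr0
  · exact (IsLocalization.AtPrime.isUnit_to_map_iff P.LocalRing P.1.asIdeal r).1 h hr

lemma ord_eq_zero_of_notMem {r : R} (hr : r ∉ P.1.asIdeal) :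
    P.ord (algebraMap R (FractionRing R) r) = 0 := by
  rw [IsScalarTower.algebraMap_apply R P.LocalRing]
  exact P.ord_algebraMap_localRing_of_isUnit
    ((IsLocalization.AtPrime.isUnit_to_map_iff P.LocalRing P.1.asIdeal r).2 hr)

lemma mem_minimalPrimes_span {r : R} (hr0 : r ≠ 0) (hr : r ∈ P.1.asIdeal) :
    P.1.asIdeal ∈ (Ideal.span {r}).minimalPrimes := by
  refine ⟨⟨P.1.isPrime, (Ideal.span_singleton_le_iff_mem _).2 hr⟩, fun Q ⟨hQ, hrQ⟩ hle => ?_⟩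
  by_contra hlt
  have h1 := Ideal.height_strict_mono_of_isPrime_of_isPrime (lt_of_le_not_ge hle hlt)
  rw [P.2, Order.lt_one_iff, Ideal.height_eq_zero_iff_eq_bot] at h1
  rw [h1, Ideal.span_singleton_le_iff_mem] at hrQ
  exact hr0 hrQ

/-- A nonzero element of the fraction field has a nonzero order along finitely many prime divisors
only. -/
lemma finite_setOf_ord_ne_zero {f : FractionRing R} (hf : f ≠ 0) :
    {P : PrimeDivisor R | P.ord f ≠ 0}.Finite := by
  have key {r : R} (hr : r ≠ 0) :
      {P : PrimeDivisor R | P.ord (algebraMap R (FractionRing R) r) ≠ 0}.Finite := by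
    refine Set.Finite.of_injOn (f := fun P : PrimeDivisor R => P.1.asIdeal)
      (t := (Ideal.span {r}).minimalPrimes) (fun P hP => ?_) (fun P _ Q _ h => ?_)
      (Ideal.finite_minimalPrimes_of_isNoetherianRing _ _)
    · exact P.mem_minimalPrimes_span hr (by_contra fun h => hP (P.ord_eq_zero_of_notMem h))
    · exact Subtype.ext (PrimeSpectrum.ext h)
  obtain ⟨a, b, hb, rfl⟩ := IsFractionRing.div_surjective (A := R) f
  have hb0 := nonZeroDivisors.ne_zero hb
  have ha0 : a ≠ 0 := by
    rintro rfl
    simp at hf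
  refine ((key ha0).union (key hb0)).subset fun P hP => ?_
  by_contra h
  simp only [Set.mem_union, Set.mem_ofPred_eq, not_or, not_not] at h
  refine hP ?_
  rw [P.ord_div (by simpa using ha0) (by simpa using hb0), h.1, h.2, sub_zero]

/-- Outside a prime ideal that contains none of finitely many primes of height one there is an
element vanishing to any given order along all of the corresponding prime divisors. -/
lemma exists_notMem_forall_le_ord (I : Ideal R) [I.IsPrime] (F : Finset (PrimeDivisor R))
    (hF : ∀ Q ∈ F, ¬ Q.1.asIdeal ≤ I) (N : ℕ) :
    ∃ u ∉ I, ∀ Q ∈ F, (N : ℤ) ≤ Q.ord (algebraMap R (FractionRing R) u) := by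
  classical
  induction F using Finset.induction_on with
  | empty => exact ⟨1, I.one_notMem, by simp⟩
  | insert Q F hQ ih =>
    obtain ⟨u, huI, hu⟩ := ih fun Q' hQ' => hF Q' (Finset.mem_insert_of_mem hQ')
    obtain ⟨a, haQ, haI⟩ := SetLike.not_le_iff_exists.1 (hF Q (Finset.mem_insert_self Q F))
    have ha0 : a ≠ 0 := fun h => haI (h ▸ I.zero_mem)
    have hu0 : u ≠ 0 := fun h => huI (h ▸ I.zero_mem)
    have hmul (P : PrimeDivisor R) : P.ord (algebraMap R (FractionRing R) (a ^ N * u)) =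
        N * P.ord (algebraMap R _ a) + P.ord (algebraMap R _ u) := by
      rw [map_mul, P.ord_mul (by simpa using fun h => absurd h ha0) (by simpa using hu0),
        map_pow, P.ord_pow]
    refine ⟨a ^ N * u, fun h => ?_, fun P hP => ?_⟩
    · rcases ‹I.IsPrime›.mem_or_mem h with h | h
      · exact haI (‹I.IsPrime›.mem_of_pow_mem N h)
      · exact huI h
    · rw [hmul]
      have h1 := P.ord_algebraMap_nonneg a
      have h2 := P.ord_algebraMap_nonneg u
      rcases Finset.mem_insert.1 hP with rfl | hP
      · have := P.one_le_ord_of_mem ha0 haQ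
        nlinarith
      · have := hu P hP
        nlinarith

end Noetherian

variable {R : Type*} [CommRing R] [IsDomain R] [IsNoetherianRing R] [IsIntegrallyClosed R]
  (P : PrimeDivisor R)

lemma exists_ord_eq (m : ℤ) : ∃ s : FractionRing R, s ≠ 0 ∧ P.ord s = m := by
  obtain ⟨ϖ, hϖ⟩ := IsDiscreteValuationRing.exists_irreducible P.LocalRing
  have h0 : algebraMap P.LocalRing (FractionRing R) ϖ ≠ 0 := by simpa using hϖ.ne_zero
  refine ⟨algebraMap _ _ ϖ ^ m, zpow_ne_zero m h0, ?_⟩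
  rw [ord_zpow, ord_algebraMap_localRing P hϖ.ne_zero, Ring.ord_of_irreducible hϖ]
  simp

lemma exists_notMem_mul_eq_of_ord_nonneg {f : FractionRing R} (hf : 0 ≤ P.ord f) :
    ∃ u ∉ P.1.asIdeal, ∃ a, algebraMap R (FractionRing R) u * f = algebraMap R _ a := by
  obtain ⟨v, hv⟩ : ∃ v : P.LocalRing, algebraMap _ _ v = f := by
    rcases ValuationRing.isInteger_or_isInteger P.LocalRing f with ⟨v, hv⟩ | ⟨v, hv⟩
    · exact ⟨v, hv⟩
    · by_cases hu : IsUnit v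
      · obtain ⟨w, rfl⟩ := hu
        refine ⟨(w⁻¹ : P.LocalRingˣ), ?_⟩
        rw [map_units_inv, hv, inv_inv]
      · by_cases hv0 : v = 0
        · refine ⟨0, ?_⟩
          rw [hv0, map_zero] at hv
          rw [map_zero, eq_comm, ← inv_eq_zero, ← hv]
        · have := P.ord_algebraMap_localRing_pos hv0 hu
          rw [hv, ord_inv] at this
          lia
  obtain ⟨a, u, rfl⟩ := IsLocalization.exists_mk'_eq P.1.asIdeal.primeCompl v
  refine ⟨u, u.2, a, ?_⟩
  rw [← hv, IsScalarTower.algebraMap_apply R P.LocalRing, ← map_mul, mul_comm,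
    IsLocalization.mk'_spec, ← IsScalarTower.algebraMap_apply]

end PrimeDivisor

/-- If `P = {r | r * y ∈ R}` is a prime ideal for some `y ∈ Frac R` outside the normal Noetherian
domain `R`, then `P` has height one: otherwise `P y ⊆ P`, so that `y` is integral over `R`. -/
lemma height_eq_one_of_conductor {R : Type*} [CommRing R] [IsDomain R] [IsNoetherianRing R]
    [IsIntegrallyClosed R] {P : Ideal R} [P.IsPrime] {y : FractionRing R}
    (hy : y ∉ (algebraMap R (FractionRing R)).range) (hP0 : P ≠ ⊥)
    (hP : ∀ r, r ∈ P ↔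
      algebraMap R (FractionRing R) r * y ∈ (algebraMap R (FractionRing R)).range) :
    P.height = 1 := by
  have hinj : Function.Injective (algebraMap R (FractionRing R)) := IsFractionRing.injective _ _
  obtain ⟨t, htP, u, hu, htu⟩ : ∃ t ∈ P, ∃ u ∉ P, algebraMap R (FractionRing R) u =
      algebraMap R _ t * y := by
    by_contra! hcon
    refine hy (IsIntegrallyClosed.isIntegral_iff.1 ?_)
    let N : Submodule R (FractionRing R) := Submodule.map (Algebra.linearMap R (FractionRing R)) P
    obtain ⟨t, ht, ht0⟩ := Submodule.exists_mem_ne_zero_of_ne_bot hP0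
    refine isIntegral_of_smul_mem_submodule (N := N) ?_ ((IsNoetherian.noetherian P).map _) y ?_
    · refine (Submodule.ne_bot_iff _).2 ⟨_, ⟨t, ht, rfl⟩, ?_⟩
      simpa using ht0
    · rintro _ ⟨r, hr, rfl⟩
      obtain ⟨v, hv⟩ := (hP r).1 hr
      refine ⟨v, by_contra fun hvP => hcon r hr v hvP hv, ?_⟩
      rw [smul_eq_mul, mul_comm]
      exact hv
  have ht0 : t ≠ 0 := by
    rintro rfl
    rw [map_zero, zero_mul, map_eq_zero_iff _ hinj] at htu
    exact hu (htu ▸ P.zero_mem)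
  have hmin : P ∈ (Ideal.span {t}).minimalPrimes := by
    refine ⟨⟨‹_›, (Ideal.span_singleton_le_iff_mem _).2 htP⟩, fun Q ⟨hQ, htQ⟩ hle r hr => ?_⟩
    obtain ⟨v, hv⟩ := (hP r).1 hr
    have h1 : u * r = t * v := hinj (by rw [map_mul, map_mul, htu, hv]; ring)
    have h2 : u * r ∈ Q := h1 ▸ Q.mul_mem_right v ((Ideal.span_singleton_le_iff_mem _).1 htQ)
    exact (hQ.mem_or_mem h2).resolve_left fun h => hu (hle h)
  refine le_antisymm (Ideal.height_le_one_of_isPrincipal_of_mem_minimalPrimes _ _ hmin) ?_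
  rw [Order.one_le_iff_ne_zero, Ne, Ideal.height_eq_zero_iff_eq_bot]
  exact hP0

/-- A Noetherian normal domain is the intersection of its localizations at primes of height one. -/
theorem mem_range_algebraMap_of_forall_ord_nonneg {R : Type*} [CommRing R] [IsDomain R]
    [IsNoetherianRing R] [IsIntegrallyClosed R] {f : FractionRing R}
    (hf : ∀ P : PrimeDivisor R, 0 ≤ P.ord f) : f ∈ (algebraMap R (FractionRing R)).range := by
  by_contra hfR
  -- `P` is an associated prime of `(R + R f) / R`.
  let N : Submodule R (FractionRing R) := 1
  have hN (y : FractionRing R) : y ∈ N ↔ y ∈ (algebraMap R (FractionRing R)).range :=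
    Submodule.mem_one
  have hfN : (Submodule.Quotient.mk f : FractionRing R ⧸ N) ≠ 0 := by
    rwa [Ne, Submodule.Quotient.mk_eq_zero, hN]
  obtain ⟨P, hP, hle⟩ := exists_le_isAssociatedPrime_of_isNoetherianRing R
    (⟨Submodule.Quotient.mk f, Submodule.mem_span_singleton_self _⟩ :
      Submodule.span R {(Submodule.Quotient.mk f : FractionRing R ⧸ N)})
    (fun h => hfN (congrArg Subtype.val h))
  rw [isAssociatedPrime_iff] at hP
  obtain ⟨hprime, ⟨y', hy'⟩, rfl⟩ := hP
  obtain ⟨c, rfl⟩ := Submodule.mem_span_singleton.1 hy'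
  set P := (⊥ : Submodule R
    (Submodule.span R {(Submodule.Quotient.mk f : FractionRing R ⧸ N)})).colon
      {⟨c • Submodule.Quotient.mk f, hy'⟩} with hPdef
  have hmem (r : R) : r ∈ P ↔
      algebraMap R (FractionRing R) r * (algebraMap R _ c * f) ∈
        (algebraMap R (FractionRing R)).range := by
    rw [hPdef, Submodule.mem_colon_singleton, Submodule.mem_bot, ← Subtype.coe_inj, ← hN,
      ← Submodule.Quotient.mk_eq_zero N]
    simp only [← Algebra.smul_def]
    rfl
  have hy : algebraMap R (FractionRing R) c * f ∉ (algebraMap R (FractionRing R)).range := by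
    intro h
    refine hprime.ne_top ((Ideal.eq_top_iff_one _).2 ((hmem 1).2 ?_))
    rwa [map_one, one_mul]
  obtain ⟨a, b, hb, hab⟩ := IsFractionRing.div_surjective (A := R) f
  have hb0 := nonZeroDivisors.ne_zero hb
  have hb0' : algebraMap R (FractionRing R) b ≠ 0 := by simpa using hb0
  have hbot : P ≠ ⊥ := by
    refine (Submodule.ne_bot_iff _).2 ⟨b, (hmem b).2 ⟨c * a, ?_⟩, hb0⟩
    rw [← hab, map_mul]
    field_simp
  let D : PrimeDivisor R := ⟨⟨P, hprime⟩, height_eq_one_of_conductor hy hbot hmem⟩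
  obtain ⟨u, hu, a', ha'⟩ := D.exists_notMem_mul_eq_of_ord_nonneg (hf D)
  refine hu ((hmem u).2 ⟨c * a', ?_⟩)
  rw [map_mul, ← ha']
  ring

/-! ### Frobenius-inverse linear maps and strong F-regularity -/

/-- The additive map `φ : R → R` is `p ^ (-e)`-linear, that is, it is an `R`-linear map
`F^e_* R → R`. -/
def IsFrobeniusInverseLinear (p e : ℕ) {R : Type*} [CommRing R] (φ : R →+ R) : Prop :=
  ∀ r s : R, φ (r ^ p ^ e * s) = r * φ s

namespace IsFrobeniusInverseLinear

variable {p : ℕ} {R : Type*} [CommRing R] {e e' : ℕ} {φ ψ : R →+ R}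

lemma comp (hφ : IsFrobeniusInverseLinear p e φ) (hψ : IsFrobeniusInverseLinear p e' ψ) :
    IsFrobeniusInverseLinear p (e + e') (φ.comp ψ) := fun r s => by
  rw [AddMonoidHom.comp_apply, pow_add, pow_mul, hψ, hφ, AddMonoidHom.comp_apply]

lemma mulLeft (hφ : IsFrobeniusInverseLinear p e φ) (a : R) :
    IsFrobeniusInverseLinear p e ((AddMonoidHom.mulLeft a).comp φ) := fun r s => by
  simp only [AddMonoidHom.comp_apply, AddMonoidHom.coe_mulLeft, hφ r s]
  ring

lemma id : IsFrobeniusInverseLinear p 0 (AddMonoidHom.id R) := fun r s => by simp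

/-- If `φ c = 1` with `c ∈ I`, then the iterates of `φ` take the value `1` at elements of
arbitrarily high powers of `I`, as `φ (d ^ p ^ e * c) = d`. -/
lemma exists_mem_pow_apply_eq_one {I : Ideal R} [Fact p.Prime]
    (hφ : IsFrobeniusInverseLinear p e φ) {c : R} (hc : c ∈ I) (h : φ c = 1) (j : ℕ) :
    ∃ ψ : R →+ R, IsFrobeniusInverseLinear p (j * e) ψ ∧ ∃ d ∈ I ^ j, ψ d = 1 := by
  induction j with
  | zero => exact ⟨AddMonoidHom.id R, by simpa using id, 1, by simp, rfl⟩
  | succ j ih =>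
    obtain ⟨ψ, hψ, d, hd, h1⟩ := ih
    refine ⟨ψ.comp φ, by simpa [add_mul] using hψ.comp hφ, d ^ p ^ e * c, ?_, ?_⟩
    · rw [pow_succ]
      exact Ideal.mul_mem_mul (Ideal.pow_mem_of_mem _ hd _
        (pow_pos (Fact.out : p.Prime).pos e)) hc
    · rw [AddMonoidHom.comp_apply, hφ, h, mul_one, h1]

end IsFrobeniusInverseLinear

/-- The ideal of all values `φ c`, where `φ` runs through the `R`-linear maps `F^e_* R → R`. -/
def traceIdeal (p e : ℕ) {R : Type*} [CommRing R] (c : R) : Ideal R where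
  carrier := {x | ∃ φ : R →+ R, IsFrobeniusInverseLinear p e φ ∧ φ c = x}
  zero_mem' := ⟨0, fun r s => by simp, rfl⟩
  add_mem' := by
    rintro _ _ ⟨φ, hφ, rfl⟩ ⟨ψ, hψ, rfl⟩
    exact ⟨φ + ψ, fun r s => by simp [hφ r s, hψ r s, mul_add], rfl⟩
  smul_mem' := by
    rintro a _ ⟨φ, hφ, rfl⟩
    exact ⟨_, hφ.mulLeft a, rfl⟩

/-- For an F-pure ring the ideals `traceIdeal p e c` increase with `e`. -/
lemma IsFPure.traceIdeal_mono {p : ℕ} [Fact p.Prime] {R : Type*} [CommRing R] (h : IsFPure p R)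
    (c : R) : Monotone fun e => traceIdeal p e c := by
  refine monotone_nat_of_le_succ fun e => ?_
  rintro _ ⟨ψ, hψ, rfl⟩
  obtain ⟨φ, hφ, hφ1⟩ := h
  have hp : p = (p - 1) + 1 := (Nat.sub_add_cancel (Fact.out : p.Prime).one_le).symm
  refine ⟨φ.comp ((AddMonoidHom.mulLeft (ψ c ^ (p - 1))).comp ψ), ?_, ?_⟩
  · rw [add_comm e 1]
    exact IsFrobeniusInverseLinear.comp hφ (hψ.mulLeft _)
  · have := hφ (ψ c) 1
    rw [pow_one, mul_one, hφ1, mul_one] at this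
    rw [AddMonoidHom.comp_apply, AddMonoidHom.comp_apply, AddMonoidHom.coe_mulLeft, ← pow_succ,
      ← hp, this]

/-- If `R` is F-finite, it is generated by finitely many elements over its subring of
`p ^ e`-th powers. -/
lemma exists_frobenius_generators {p : ℕ} [Fact p.Prime] {R : Type*} [CommRing R] [CharP R p]
    (hF : (frobenius R p).Finite) (e : ℕ) :
    ∃ T : Finset R, ∀ s : R, ∃ a : R → R, s = ∑ t ∈ T, a t ^ p ^ e * t := by
  obtain ⟨T, hT⟩ := (FrobeniusPushforward.finite p e R hF).fg_top
  have hs (s : FrobeniusPushforward p e R) : ∃ a : FrobeniusPushforward p e R → R,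
      s = ∑ t ∈ T, a t • t := by
    have h : s ∈ Submodule.span R (T : Set (FrobeniusPushforward p e R)) :=
      hT ▸ Submodule.mem_top
    obtain ⟨a, -, ha⟩ := Submodule.mem_span_finset.1 h
    exact ⟨a, ha.symm⟩
  exact ⟨T, hs⟩

section Localization

variable {p : ℕ} [Fact p.Prime] {R : Type*} [CommRing R] [IsDomain R] [CharP R p]

/-- Up to a denominator, a `p ^ (-e)`-linear map of a localization of an F-finite domain restricts
to the domain itself. -/
lemma exists_notMem_traceIdeal_of_localization (hF : (frobenius R p).Finite) {P : Ideal R}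
    [P.IsPrime] (hP : IsStronglyFRegular p (Localization.AtPrime P)) {c : R} (hc : c ≠ 0) :
    ∃ e, ∃ u ∉ P, u ∈ traceIdeal p e c := by
  have hinj : Function.Injective (algebraMap R (Localization.AtPrime P)) :=
    IsLocalization.injective _ P.primeCompl_le_nonZeroDivisors
  obtain ⟨e, -, ψ, hψ, hψc⟩ := hP (algebraMap R _ c) (by
    rw [IsDomain.minimalPrimes_eq_singleton_bot]
    rintro Q rfl
    simpa using hc)
  obtain ⟨T, hT⟩ := exists_frobenius_generators hF e
  classical
  obtain ⟨⟨u, hu⟩, hb⟩ := IsLocalization.exist_integer_multiples_of_finset P.primeCompl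
    (T.image fun t => ψ (algebraMap R _ t))
  choose! v hv using fun t (ht : t ∈ T) => hb _ (Finset.mem_image_of_mem _ ht)
  have hex (s : R) : ∃ x, algebraMap R (Localization.AtPrime P) x =
      algebraMap R _ u * ψ (algebraMap R _ s) := by
    obtain ⟨a, rfl⟩ := hT s
    refine ⟨∑ t ∈ T, a t * v t, ?_⟩
    simp only [map_sum, map_mul, map_pow, Finset.mul_sum, hψ]
    refine Finset.sum_congr rfl fun t ht => ?_
    rw [hv t ht, Algebra.smul_def]
    ring
  choose f hf using hex
  refine ⟨e, u, hu, ⟨⟨f, ?_⟩, ?_⟩, fun r s => hinj ?_, hinj ?_⟩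
  · exact hinj (by rw [hf, map_zero, map_zero, mul_zero])
  · exact fun a b => hinj (by rw [hf, map_add, map_add, mul_add, map_add, hf, hf])
  · change algebraMap R _ (f (r ^ p ^ e * s)) = algebraMap R _ (r * f s)
    rw [hf, map_mul (algebraMap R _), map_mul (algebraMap R _), hf, map_pow, hψ]
    ring
  · change algebraMap R _ (f c) = _
    rw [hf, hψc, mul_one]

/-- Suppose that `R` is F-pure and strongly F-regular on the punctured spectrum, but not strongly
F-regular. Then every `R`-linear map `F^e_* R → R` maps the maximal ideal into itself. Indeed, for
`b ≠ 0` and large `n` the ideal `traceIdeal p n b` contains a power of the maximal ideal. If `φ`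
took the value `1` on the maximal ideal, an iterate of `φ` would do so at some element of that
power, and its composite with a map taking `b` to that element would take `b` to `1`. -/
theorem IsFrobeniusInverseLinear.apply_mem_maximalIdeal [IsNoetherianRing R] [IsLocalRing R]
    (hF : (frobenius R p).Finite) (hpure : IsFPure p R) (hnot : ¬ IsStronglyFRegular p R)
    (hloc : ∀ (P : Ideal R) [P.IsPrime], P ≠ IsLocalRing.maximalIdeal R →
      IsStronglyFRegular p (Localization.AtPrime P)) {e : ℕ} {φ : R →+ R}
    (hφ : IsFrobeniusInverseLinear p e φ) {c : R} (hc : c ∈ IsLocalRing.maximalIdeal R) :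
    φ c ∈ IsLocalRing.maximalIdeal R := by
  by_contra hunit
  obtain ⟨v, hv⟩ := (not_not.1 hunit : IsUnit (φ c)).exists_left_inv
  refine hnot fun b hb => ?_
  have hb0 : b ≠ 0 := by
    rw [IsDomain.minimalPrimes_eq_singleton_bot] at hb
    exact fun h => hb ⊥ rfl (by simp [h])
  have hmono := hpure.traceIdeal_mono b
  obtain ⟨n, hn⟩ := monotone_stabilizes_iff_noetherian.2 ‹IsNoetherianRing R›
    ⟨fun e => traceIdeal p e b, hmono⟩
  -- Strong F-regularity on the punctured spectrum shows that `traceIdeal p n b` lies in no prime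
  -- other than the maximal ideal.
  have hrad : IsLocalRing.maximalIdeal R ≤ (traceIdeal p n b).radical := by
    rw [Ideal.radical_eq_sInf]
    refine le_sInf fun Q ⟨hQ, hQp⟩ => ?_
    by_contra hne
    obtain ⟨e', u, hu, hub⟩ := exists_notMem_traceIdeal_of_localization hF
      (hloc Q fun h => hne h.ge) hb0
    refine hu (hQ ?_)
    rcases le_total e' n with h | h
    · exact hmono h hub
    · have : traceIdeal p n b = traceIdeal p e' b := hn e' h
      rwa [this]
  obtain ⟨N, hN⟩ := Ideal.exists_radical_pow_le_of_fg _
    (IsNoetherian.noetherian (traceIdeal p n b).radical)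
  obtain ⟨ψ, hψ, d, hd, hψd⟩ := (hφ.mulLeft v).exists_mem_pow_apply_eq_one hc hv N
  obtain ⟨θ, hθ, hθb⟩ := hmono (Nat.le_succ n) (hN (Ideal.pow_right_mono hrad N hd))
  exact ⟨N * e + (n + 1), by lia, ψ.comp θ, hψ.comp hθ, by
    rw [AddMonoidHom.comp_apply, hθb, hψd]⟩

end Localization

/-! ### The trace of Frobenius on the fraction field -/

section Trace

variable {p : ℕ} [Fact p.Prime] {R : Type*} [CommRing R] [IsDomain R]

/-- A Frobenius-inverse linear map `R → Frac R` extends to `Frac R`. -/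
lemma exists_frobenius_extension (h : R →+ FractionRing R)
    (hh : ∀ r s, h (r ^ p * s) = algebraMap R _ r * h s) :
    ∃ T : FractionRing R →+ FractionRing R, (∀ a f, T (a ^ p * f) = a * T f) ∧
      ∀ r, T (algebraMap R _ r) = h r := by
  have hinj : Function.Injective (algebraMap R (FractionRing R)) := IsFractionRing.injective _ _
  have hp : p = (p - 1) + 1 := (Nat.sub_add_cancel (Fact.out : p.Prime).one_le).symm
  have hp' (b : R) : b ^ p = b * b ^ (p - 1) := by conv_lhs => rw [hp, pow_succ']
  choose num den hden hnd using IsFractionRing.div_surjective (A := R) (K := FractionRing R)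
  have hd0 (f) : algebraMap R (FractionRing R) (den f) ≠ 0 := by
    simpa using nonZeroDivisors.ne_zero (hden f)
  have hspec (f) : algebraMap R _ (den f) * f = algebraMap R _ (num f) := by
    rw [mul_comm]
    exact ((div_eq_iff (hd0 f)).1 (hnd f)).symm
  -- The value `h (a * b ^ (p - 1)) / b` at `a / b` does not depend on the representation.
  have key (a b : R) (hb : b ≠ 0) (f : FractionRing R)
      (hf : algebraMap R _ b * f = algebraMap R _ a) :
      algebraMap R _ b * (h (num f * den f ^ (p - 1)) / algebraMap R _ (den f)) =
        h (a * b ^ (p - 1)) := by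
    have h1 : b * num f = den f * a := by
      apply hinj
      rw [map_mul, map_mul, ← hf, ← hspec f]
      ring
    rw [mul_div_assoc', div_eq_iff (hd0 f), ← hh, mul_comm (h _), ← hh]
    congr 1
    rw [hp' b, hp' (den f)]
    linear_combination (b ^ (p - 1) * den f ^ (p - 1)) * h1
  let T₀ (f : FractionRing R) := h (num f * den f ^ (p - 1)) / algebraMap R _ (den f)
  refine ⟨⟨⟨T₀, ?_⟩, fun f g => ?_⟩, fun a f => ?_, fun r => ?_⟩
  · have := key 0 1 one_ne_zero 0 (by simp)
    rwa [map_one, one_mul, zero_mul, map_zero] at this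
  · have hb : den f * den g ≠ 0 := mul_ne_zero (nonZeroDivisors.ne_zero (hden f))
      (nonZeroDivisors.ne_zero (hden g))
    have hb' : algebraMap R (FractionRing R) (den f * den g) ≠ 0 := by
      rw [map_mul]; exact mul_ne_zero (hd0 f) (hd0 g)
    have h1 := key (num f * den g) _ hb f (by rw [map_mul, map_mul, ← hspec]; ring)
    have h2 := key (num g * den f) _ hb g (by rw [map_mul, map_mul, ← hspec g]; ring)
    have h3 := key (num f * den g + num g * den f) _ hb (f + g) (by
      rw [map_mul, map_add, map_mul, map_mul, ← hspec f, ← hspec g]; ring)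
    refine mul_left_cancel₀ hb' ?_
    rw [mul_add]
    exact h3.trans (by rw [add_mul, map_add, ← h1, ← h2])
  · have hb : den a ^ p * den f ≠ 0 := mul_ne_zero (pow_ne_zero p
      (nonZeroDivisors.ne_zero (hden a))) (nonZeroDivisors.ne_zero (hden f))
    have h1 := key (num a ^ p * num f) _ hb (a ^ p * f) (by
      rw [map_mul, map_mul, map_pow, map_pow, ← hspec f, ← hspec a]; ring)
    have h2 := key (num f) _ (nonZeroDivisors.ne_zero (hden f)) f (hspec f)
    have h3 : num a ^ p * num f * (den a ^ p * den f) ^ (p - 1) =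
        (num a * den a ^ (p - 1)) ^ p * (num f * den f ^ (p - 1)) := by ring
    rw [h3, hh, ← h2, map_mul (algebraMap R _), map_mul (algebraMap R _), ← hspec a,
      map_pow (algebraMap R _), map_pow (algebraMap R _)] at h1
    have hne : algebraMap R (FractionRing R) (den a) ^ p * algebraMap R _ (den f) ≠ 0 :=
      mul_ne_zero (pow_ne_zero p (hd0 a)) (hd0 f)
    refine mul_left_cancel₀ hne (h1.trans ?_)
    change _ = _ * (a * (h (num f * den f ^ (p - 1)) / algebraMap R _ (den f)))
    have h4 : algebraMap R (FractionRing R) (den a) ^ p =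
      algebraMap R _ (den a) * algebraMap R _ (den a) ^ (p - 1) := by rw [← map_pow, hp']; simp
    rw [h4]
    ring
  · have := key r 1 one_ne_zero (algebraMap R _ r) (by simp)
    simpa using this

/-- The duality `F_* ω ≅ Hom_R(F_* R, ω)` for a fractional ideal `ω` is given by a single
Frobenius-inverse linear map `T` on the fraction field, the trace of Frobenius. Maps `F_* R → R` are
represented by `T` as well, since `a R ⊆ ω` for some `a ≠ 0`. -/
theorem exists_frobenius_trace {ω : Submodule R (FractionRing R)} (hω : ω ≠ ⊥)
    {Ψ : ω →+ (R →+ ω)} (hΨ : Function.Injective Ψ)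
    (hlin : ∀ w r s, Ψ w (r ^ p * s) = r • Ψ w s) (hsmul : ∀ (s : R) w t, Ψ (s • w) t = Ψ w (t * s))
    (hsurj : ∀ h : R →+ ω, (∀ r s, h (r ^ p * s) = r • h s) → ∃ w, Ψ w = h) :
    ∃ T : FractionRing R →+ FractionRing R, (∀ a f, T (a ^ p * f) = a * T f) ∧
      (∀ f ∈ ω, T f ∈ ω) ∧
      (∀ f, (∀ r : R, T (f * algebraMap R _ r) ∈ ω) → f ∈ ω) ∧
      ∀ φ : R →+ R, IsFrobeniusInverseLinear p 1 φ →
        ∃ f, ∀ r, algebraMap R _ (φ r) = T (f * algebraMap R _ r) := by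
  obtain ⟨w₀, hw₀, hw₀0⟩ := Submodule.exists_mem_ne_zero_of_ne_bot hω
  obtain ⟨T₀, hT₀, hT₀h⟩ := exists_frobenius_extension (p := p)
    (ω.subtype.toAddMonoidHom.comp (Ψ ⟨w₀, hw₀⟩)) (fun r s => by
      simp [hlin, Algebra.smul_def])
  let T : FractionRing R →+ FractionRing R := T₀.comp (AddMonoidHom.mulLeft w₀⁻¹)
  have hTdef (f) : T f = T₀ (w₀⁻¹ * f) := rfl
  have hT (a f) : T (a ^ p * f) = a * T f := by rw [hTdef, hTdef, ← hT₀, mul_left_comm]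
  have hp : p = (p - 1) + 1 := (Nat.sub_add_cancel (Fact.out : p.Prime).one_le).symm
  have hp' (b : R) : b ^ p = b ^ (p - 1) * b := by conv_lhs => rw [hp, pow_succ]
  -- By `F_* R`-linearity, all the maps `Ψ w` are given by the same `T`.
  have hTΨ (w : ω) (t : R) : (Ψ w t : FractionRing R) = T (w * algebraMap R _ t) := by
    obtain ⟨a, b, hb, hab⟩ := IsFractionRing.div_surjective (A := R) (w₀⁻¹ * (w : FractionRing R))
    have hb0 : algebraMap R (FractionRing R) b ≠ 0 := by simpa using nonZeroDivisors.ne_zero hb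
    have hbw : b • w = a • (⟨w₀, hw₀⟩ : ω) := by
      refine Subtype.ext ?_
      simp only [Submodule.coe_smul, Algebra.smul_def]
      rw [div_eq_iff hb0] at hab
      rw [hab]
      field_simp
    refine mul_left_cancel₀ hb0 ?_
    have h1 : algebraMap R (FractionRing R) b * (Ψ w t : FractionRing R) =
        (Ψ w (b ^ p * t) : FractionRing R) := by
      rw [hlin, Submodule.coe_smul, Algebra.smul_def]
    have h2 : Ψ w (b ^ p * t) = Ψ ⟨w₀, hw₀⟩ (b ^ (p - 1) * t * a) := by
      rw [← hsmul a ⟨w₀, hw₀⟩, ← hbw, hsmul, hp']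
      congr 1
      ring
    have h3 := hT₀h (b ^ (p - 1) * t * a)
    rw [h1, h2, ← hT, hTdef]
    refine h3.symm.trans (congrArg T₀ ?_)
    rw [mul_left_comm, ← mul_assoc w₀⁻¹, ← hab, ← map_pow, hp']
    simp only [map_mul]
    field_simp
  have hTinj (f : FractionRing R) (hf : ∀ r : R, T (f * algebraMap R _ r) = 0) : f = 0 := by
    by_contra hf0
    obtain ⟨a, b, hb, hab⟩ := IsFractionRing.div_surjective (A := R) (w₀ / f)
    have hb0 : algebraMap R (FractionRing R) b ≠ 0 := by simpa using nonZeroDivisors.ne_zero hb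
    suffices h0 : (⟨w₀, hw₀⟩ : ω) = 0 from hw₀0 (congrArg Subtype.val h0)
    refine (map_eq_zero_iff Ψ hΨ).1 (DFunLike.ext _ _ fun t => Subtype.ext ?_)
    have h1 : w₀ * algebraMap R _ t = (algebraMap R _ b)⁻¹ ^ p *
        (f * algebraMap R _ (a * b ^ (p - 1) * t)) := by
      have h2 : w₀ = algebraMap R _ a / algebraMap R _ b * f := by
        rw [hab]; field_simp
      rw [h2, inv_pow, ← map_pow, hp']
      simp only [map_mul, map_pow]
      field_simp
    rw [hTΨ]
    change T (w₀ * _) = 0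
    rw [h1, hT, hf, mul_zero]
  have hrep (h : R → FractionRing R) (hh : ∀ r, h r ∈ ω) (hadd : ∀ r s, h (r + s) = h r + h s)
      (hl : ∀ r s, h (r ^ p * s) = algebraMap R _ r * h s) :
      ∃ w ∈ ω, ∀ r, h r = T (w * algebraMap R _ r) := by
    obtain ⟨w, hw⟩ := hsurj (AddMonoidHom.mk' (fun r => ⟨h r, hh r⟩)
      fun r s => Subtype.ext (hadd r s)) fun r s => Subtype.ext (by
        rw [Submodule.coe_smul, Algebra.smul_def]
        exact hl r s)
    refine ⟨w, w.2, fun r => ?_⟩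
    rw [← hTΨ, hw]
    rfl
  refine ⟨T, hT, fun f hf => ?_, fun f hf => ?_, fun φ hφ => ?_⟩
  · have := (Ψ ⟨f, hf⟩ 1).2
    rwa [hTΨ, map_one, mul_one] at this
  · obtain ⟨w, hw, hfw⟩ := hrep _ hf (fun r s => by rw [map_add, mul_add, map_add])
      (fun r s => by
        rw [map_mul (algebraMap R _), map_pow (algebraMap R _), mul_left_comm, hT])
    have : f - w = 0 := hTinj _ fun r => by rw [sub_mul, map_sub, hfw, sub_self]
    rwa [sub_eq_zero.1 this]
  · obtain ⟨a, b, hb, hab⟩ := IsFractionRing.div_surjective (A := R) w₀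
    have hb0 : algebraMap R (FractionRing R) b ≠ 0 := by simpa using nonZeroDivisors.ne_zero hb
    have ha : algebraMap R (FractionRing R) a ∈ ω := by
      have h1 : algebraMap R (FractionRing R) a = b • w₀ := by
        rw [← hab, Algebra.smul_def]; field_simp
      rw [h1]
      exact ω.smul_mem b hw₀
    have ha0 : algebraMap R (FractionRing R) a ≠ 0 := by
      intro h
      rw [h, zero_div] at hab
      exact hw₀0 hab.symm
    obtain ⟨w, -, hw⟩ := hrep (fun r => algebraMap R _ (φ r) * algebraMap R _ a)
      (fun r => by rw [← Algebra.smul_def]; exact ω.smul_mem _ ha)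
      (fun r s => by rw [map_add, map_add, add_mul])
      (fun r s => by
        have := hφ r s
        rw [pow_one] at this
        rw [this, map_mul, mul_assoc])
    refine ⟨(algebraMap R _ a)⁻¹ ^ p * w, fun r => ?_⟩
    rw [mul_assoc, hT, ← hw]
    field_simp

end Trace

/-! ### The trace of Frobenius and orders along prime divisors -/

namespace WeilDivisor

lemma iterate_trace_pow_mul {p : ℕ} {R : Type*} [CommRing R] {T : FractionRing R →+ FractionRing R}
    (hT : ∀ a f, T (a ^ p * f) = a * T f) (j : ℕ)
    (a f : FractionRing R) :
    T^[j] (a ^ p ^ j * f) = a * T^[j] f := by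
  induction j generalizing a f with
  | zero => simp
  | succ j ih =>
    rw [Function.iterate_succ_apply, pow_succ, pow_mul, hT, ih, Function.iterate_succ_apply]

section

variable {R : Type*} [CommRing R] [IsDomain R] [IsNoetherianRing R] [IsIntegrallyClosed R]
  (K : WeilDivisor R)

lemma divisorialIdeal_ne_bot : K.divisorialIdeal ≠ ⊥ := by
  obtain ⟨u, hu, hord⟩ := PrimeDivisor.exists_notMem_forall_le_ord (⊥ : Ideal R) K.support
    (fun Q _ h => Ideal.ne_bot_of_height_eq_one Q.2 (le_bot_iff.1 h))
    (∑ Q ∈ K.support, (K Q).natAbs)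
  refine (Submodule.ne_bot_iff _).2 ⟨algebraMap R _ u, fun _ P => ?_, by simpa using hu⟩
  by_cases hP : P ∈ K.support
  · have h1 := hord P hP
    have h2 := Finset.single_le_sum (f := fun Q => (K Q).natAbs) (fun _ _ => Nat.zero_le _) hP
    lia
  · rw [Finsupp.notMem_support_iff.1 hP, add_zero]
    exact P.ord_algebraMap_nonneg u

/-- Finitely many elements that lie in `R(K)` locally at the prime divisor `P` lie in `R(K)` after
multiplication by an element outside `P`. -/
lemma exists_notMem_forall_mul_mem (P : PrimeDivisor R) (F : Finset (FractionRing R))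
    (hF : ∀ f ∈ F, f ≠ 0 → 0 ≤ P.ord f + K P) :
    ∃ u ∉ P.1.asIdeal, ∀ f ∈ F, algebraMap R _ u * f ∈ K.divisorialIdeal := by
  classical
  have hfin : {Q : PrimeDivisor R | ∃ f ∈ F, f ≠ 0 ∧ Q.ord f ≠ 0}.Finite := by
    refine (F.finite_toSet.biUnion (t := fun f => {Q : PrimeDivisor R | f ≠ 0 ∧ Q.ord f ≠ 0})
      fun f _ => ?_).subset ?_
    · by_cases hf : f = 0
      · simp [hf]
      · exact (PrimeDivisor.finite_setOf_ord_ne_zero hf).subset fun Q hQ => hQ.2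
    · rintro Q ⟨f, hf, h⟩
      exact Set.mem_biUnion hf h
  let G := (hfin.toFinset ∪ K.support).erase P
  obtain ⟨u, hu, hord⟩ := PrimeDivisor.exists_notMem_forall_le_ord P.1.asIdeal G
    (fun Q hQ => PrimeDivisor.not_le_of_ne (Finset.ne_of_mem_erase hQ))
    (∑ Q ∈ G, ∑ f ∈ F, (Q.ord f + K Q).natAbs)
  refine ⟨u, hu, fun f hf hne Q => ?_⟩
  have hu0 : algebraMap R (FractionRing R) u ≠ 0 := left_ne_zero_of_mul hne
  have hf0 : f ≠ 0 := right_ne_zero_of_mul hne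
  rw [Q.ord_mul hu0 hf0]
  by_cases hQP : Q = P
  · have := hF f hf hf0
    have := P.ord_algebraMap_nonneg u
    rw [hQP]
    lia
  · by_cases hQ : Q ∈ G
    · have h1 := hord Q hQ
      have h2 := Finset.single_le_sum (f := fun Q => ∑ f ∈ F, (Q.ord f + K Q).natAbs)
        (fun _ _ => Nat.zero_le _) hQ
      have h3 := Finset.single_le_sum (f := fun f => (Q.ord f + K Q).natAbs)
        (fun _ _ => Nat.zero_le _) hf
      lia
    · simp only [G, Finset.mem_erase, Finset.mem_union, Set.Finite.mem_toFinset, Set.mem_ofPred_eq,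
        Finsupp.mem_support_iff, not_and, not_or, not_exists, not_not] at hQ
      have h1 := (hQ hQP).1 f hf hf0
      have h2 := (hQ hQP).2
      have := Q.ord_algebraMap_nonneg u
      lia

end

variable {p : ℕ} [Fact p.Prime] {R : Type*} [CommRing R] [IsDomain R] [IsNoetherianRing R]
  [IsIntegrallyClosed R] {K : WeilDivisor R} {T : FractionRing R →+ FractionRing R}

/-- If the trace of Frobenius preserves `R(K)`, it preserves it locally at each prime divisor. -/
lemma ord_trace_add_nonneg (hT : ∀ a f, T (a ^ p * f) = a * T f)
    (hK : ∀ f ∈ K.divisorialIdeal, T f ∈ K.divisorialIdeal) (P : PrimeDivisor R)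
    {f : FractionRing R} (hf : f ≠ 0 → 0 ≤ P.ord f + K P) : T f ≠ 0 → 0 ≤ P.ord (T f) + K P := by
  intro hTf
  obtain ⟨u, hu, huf⟩ := K.exists_notMem_forall_mul_mem P {f} (by simpa using hf)
  have hp : p = (p - 1) + 1 := (Nat.sub_add_cancel (Fact.out : p.Prime).one_le).symm
  have h1 : algebraMap R _ u ^ p * f ∈ K.divisorialIdeal := by
    have := K.divisorialIdeal.smul_mem (u ^ (p - 1)) (huf f (Finset.mem_singleton_self f))
    rwa [Algebra.smul_def, map_pow, ← mul_assoc, ← pow_succ, ← hp] at this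
  have hu0 : algebraMap R (FractionRing R) u ≠ 0 := by
    simpa using fun h : u = 0 => hu (h ▸ Ideal.zero_mem _)
  have h2 := hK _ h1
  rw [hT] at h2
  have h3 := h2 (mul_ne_zero hu0 hTf) P
  rwa [P.ord_mul hu0 hTf, P.ord_eq_zero_of_notMem hu, zero_add] at h3

lemma le_ord_trace (hT : ∀ a f, T (a ^ p * f) = a * T f)
    (hK : ∀ f ∈ K.divisorialIdeal, T f ∈ K.divisorialIdeal) (P : PrimeDivisor R) (m : ℤ)
    {f : FractionRing R} (hf : f ≠ 0 → p * m ≤ P.ord f + K P) :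
    T f ≠ 0 → m ≤ P.ord (T f) + K P := by
  intro hTf
  obtain ⟨s, hs0, hs⟩ := P.exists_ord_eq m
  have hsf : T f = s * T (s⁻¹ ^ p * f) := by rw [hT, mul_inv_cancel_left₀ hs0]
  have hne : T (s⁻¹ ^ p * f) ≠ 0 := fun h => hTf (by rw [hsf, h, mul_zero])
  have := ord_trace_add_nonneg hT hK P (f := s⁻¹ ^ p * f) (fun h => by
    have hf0 := right_ne_zero_of_mul h
    have := hf hf0
    rw [P.ord_mul (left_ne_zero_of_mul h) hf0, P.ord_pow, P.ord_inv, hs]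
    lia) hne
  rw [hsf, P.ord_mul hs0 hne, hs]
  lia

lemma le_ord_iterate_trace (hT : ∀ a f, T (a ^ p * f) = a * T f)
    (hK : ∀ f ∈ K.divisorialIdeal, T f ∈ K.divisorialIdeal) (P : PrimeDivisor R) (m : ℤ) (j : ℕ)
    {f : FractionRing R} (hf : f ≠ 0 → p ^ j * m ≤ P.ord f + K P) :
    T^[j] f ≠ 0 → m ≤ P.ord (T^[j] f) + K P := by
  induction j generalizing f with
  | zero => simpa using hf
  | succ j ih =>
    rw [Function.iterate_succ_apply]
    refine ih (le_ord_trace hT hK P _ fun h => ?_)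
    have := hf h
    rwa [pow_succ', mul_assoc] at this

/-- If `f` is such that the trace of Frobenius maps `f R` into the local ring at `P`, then
`f` has order at least `(p - 1) K` along `P`. -/
lemma le_ord_of_forall_trace [CharP R p] (hF : (frobenius R p).Finite)
    (hT : ∀ a f, T (a ^ p * f) = a * T f)
    (hK : ∀ f, (∀ r : R, T (f * algebraMap R _ r) ∈ K.divisorialIdeal) → f ∈ K.divisorialIdeal)
    (P : PrimeDivisor R) {f : FractionRing R} (hf0 : f ≠ 0)
    (hf : ∀ r : R, 0 ≤ P.ord (T (f * algebraMap R _ r))) : ((p : ℤ) - 1) * K P ≤ P.ord f := by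
  classical
  obtain ⟨s, hs0, hs⟩ := P.exists_ord_eq (-K P)
  obtain ⟨S, hS⟩ := exists_frobenius_generators hF 1
  rw [pow_one] at hS
  obtain ⟨u, hu, huf⟩ := K.exists_notMem_forall_mul_mem P
    (S.image fun t => s * T (f * algebraMap R _ t)) (by
      simp only [Finset.mem_image, forall_exists_index, and_imp]
      rintro _ t - rfl h
      rw [P.ord_mul hs0 (right_ne_zero_of_mul h), hs]
      have := hf t
      lia)
  have hu0 : algebraMap R (FractionRing R) u ≠ 0 := by
    simpa using fun h : u = 0 => hu (h ▸ Ideal.zero_mem _)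
  have h1 : (algebraMap R _ u * s) ^ p * f ∈ K.divisorialIdeal := by
    refine hK _ fun r => ?_
    obtain ⟨a, ha⟩ := hS r
    have h2 : T ((algebraMap R _ u * s) ^ p * f * algebraMap R _ r) =
        ∑ t ∈ S, a t • (algebraMap R _ u * (s * T (f * algebraMap R _ t))) := by
      rw [ha, map_sum (algebraMap R _), Finset.mul_sum, map_sum]
      refine Finset.sum_congr rfl fun t _ => ?_
      rw [map_mul (algebraMap R _), map_pow (algebraMap R _), Algebra.smul_def, mul_assoc, hT,
        mul_left_comm f, hT]
      ring
    rw [h2]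
    exact Submodule.sum_mem _ fun t ht => Submodule.smul_mem _ _
      (huf _ (Finset.mem_image_of_mem _ ht))
  have h3 := h1 (mul_ne_zero (pow_ne_zero p (mul_ne_zero hu0 hs0)) hf0) P
  rw [P.ord_mul (pow_ne_zero p (mul_ne_zero hu0 hs0)) hf0, P.ord_pow, P.ord_mul hu0 hs0,
    P.ord_eq_zero_of_notMem hu, hs] at h3
  linarith

end WeilDivisor

/-! ### The index -/

lemma exists_dvd_prime_pow_mul {p : ℕ} (hp : p.Prime) {n : ℕ} (hn : 0 < n) :
    ∃ b e : ℕ, 0 < e ∧ n ∣ p ^ b * (p ^ e - 1) := by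
  obtain ⟨b, m, hm, rfl⟩ := Nat.exists_eq_pow_mul_and_not_dvd hn.ne' p hp.ne_one
  have hm0 : 0 < m := Nat.pos_of_ne_zero fun h => hm (h ▸ dvd_zero p)
  refine ⟨b, m.totient, Nat.totient_pos.2 hm0, Nat.mul_dvd_mul_left _ ?_⟩
  exact (Nat.modEq_iff_dvd' (Nat.one_le_pow _ _ hp.pos)).1
    (Nat.ModEq.pow_totient ((Nat.Prime.coprime_iff_not_dvd hp).2 hm)).symm

lemma geom_sum_mul_sub_one (p j : ℕ) :
    ((∑ i ∈ Finset.range j, p ^ i : ℕ) : ℤ) * ((p : ℤ) - 1) = (p : ℤ) ^ j - 1 := by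
  push_cast
  exact geom_sum_mul _ _

lemma WeilDivisor.dvd_of_isPrincipal {R : Type*} [CommRing R] [IsDomain R] [IsNoetherianRing R]
    {K : WeilDivisor R} {n m : ℕ}
    (hn : IsLeast {m : ℕ | 0 < m ∧ WeilDivisor.IsPrincipal (m • K)} n)
    (hm : WeilDivisor.IsPrincipal (m • K)) : n ∣ m := by
  obtain ⟨⟨hn0, g, hg0, hg⟩, hle⟩ := hn
  obtain ⟨f, hf0, hf⟩ := hm
  by_contra hdvd
  have hpos : 0 < m % n := Nat.pos_of_ne_zero fun h => hdvd (Nat.dvd_of_mod_eq_zero h)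
  refine (Nat.mod_lt m hn0).not_ge (hle ⟨hpos, f / g ^ (m / n), div_ne_zero hf0
    (pow_ne_zero _ hg0), fun P => ?_⟩)
  rw [P.ord_div hf0 (pow_ne_zero _ hg0), P.ord_pow, ← hf, ← hg]
  have h1 : ((m % n : ℕ) : ℤ) + n * (m / n : ℕ) = m := by exact_mod_cast Nat.mod_add_div m n
  simp only [Finsupp.smul_apply, nsmul_eq_mul]
  linear_combination (K P) * h1

/-- If every `R`-linear map `F^e_* R → R` maps the maximal ideal into itself, then for an F-pure
ring the divisor `(p - 1) K` is principal: a Frobenius splitting `φ` is `T (f * ·)` for the trace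
`T` of Frobenius, `div f ≥ (p - 1) K`, and a strict inequality would give a map `F^e_* R → R` with
the value `1` at a nonunit. -/
theorem WeilDivisor.isPrincipal_sub_one_smul {p : ℕ} [Fact p.Prime] {R : Type*} [CommRing R]
    [IsDomain R] [IsNoetherianRing R] [IsIntegrallyClosed R] [IsLocalRing R] [CharP R p]
    (hF : (frobenius R p).Finite) (hpure : IsFPure p R)
    (hmax : ∀ (e : ℕ) (φ : R →+ R), IsFrobeniusInverseLinear p e φ →
      ∀ c ∈ IsLocalRing.maximalIdeal R, φ c ∈ IsLocalRing.maximalIdeal R)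
    {K : WeilDivisor R} {T : FractionRing R →+ FractionRing R}
    (hT : ∀ a f, T (a ^ p * f) = a * T f)
    (hK : ∀ f ∈ K.divisorialIdeal, T f ∈ K.divisorialIdeal)
    (hK' : ∀ f, (∀ r : R, T (f * algebraMap R _ r) ∈ K.divisorialIdeal) → f ∈ K.divisorialIdeal)
    (hrep : ∀ φ : R →+ R, IsFrobeniusInverseLinear p 1 φ →
      ∃ f, ∀ r, algebraMap R _ (φ r) = T (f * algebraMap R _ r))
    {n : ℕ} (hn : 0 < n) (hnK : WeilDivisor.IsPrincipal (n • K)) :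
    WeilDivisor.IsPrincipal ((p - 1) • K) := by
  have hp := (Fact.out : p.Prime)
  have hinj : Function.Injective (algebraMap R (FractionRing R)) := IsFractionRing.injective _ _
  obtain ⟨φ, hφ, hφ1⟩ := hpure
  obtain ⟨f, hf⟩ := hrep φ hφ
  have hf0 : f ≠ 0 := by
    rintro rfl
    have := hf 1
    rw [hφ1, map_one, zero_mul, map_zero] at this
    exact one_ne_zero this
  let c (j : ℕ) := ∑ i ∈ Finset.range j, p ^ i
  have hc (j : ℕ) : (c j : ℤ) * ((p : ℤ) - 1) = (p : ℤ) ^ j - 1 := geom_sum_mul_sub_one p j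
  have hcadd (b e : ℕ) : c (b + e) = c b + c e * p ^ b := by
    simp only [c, Finset.sum_range_add, Finset.sum_mul, pow_add, mul_comm]
  -- The iterates of the splitting are represented by the powers of `f` with exponent `c j`.
  have hiter (j : ℕ) (r : R) :
      algebraMap R (FractionRing R) (φ^[j] r) = T^[j] (f ^ c j * algebraMap R _ r) := by
    induction j with
    | zero => simp [c]
    | succ j ih =>
      have h1 : c (j + 1) = p ^ j + c j := by simp only [c, Finset.sum_range_succ, add_comm]
      rw [Function.iterate_succ_apply', hf, ih, Function.iterate_succ_apply',
        ← WeilDivisor.iterate_trace_pow_mul hT, h1, pow_add, mul_assoc]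
  have hφiter (j : ℕ) : φ^[j] 1 = 1 := Function.iterate_fixed hφ1 j
  have hordf (P : PrimeDivisor R) : ((p : ℤ) - 1) * K P ≤ P.ord f :=
    WeilDivisor.le_ord_of_forall_trace hF hT hK' P hf0 fun r => by
      rw [← hf]
      exact P.ord_algebraMap_nonneg _
  -- As `n` divides `p ^ b * (p ^ e - 1)`, the divisor `p ^ b * (p ^ e - 1) * K` is principal.
  obtain ⟨b, e, he, k, hk⟩ := exists_dvd_prime_pow_mul hp hn
  obtain ⟨g₀, hg₀0, hg₀⟩ := hnK
  let g := g₀ ^ k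
  have hg0 : g ≠ 0 := pow_ne_zero k hg₀0
  have hordg (P : PrimeDivisor R) : P.ord g = (p : ℤ) ^ b * ((p : ℤ) ^ e - 1) * K P := by
    have h1 : (p : ℤ) ^ b * ((p : ℤ) ^ e - 1) = n * k := by
      have h2 : 1 ≤ p ^ e := Nat.one_le_pow _ _ hp.pos
      have h3 : ((p ^ b * (p ^ e - 1) : ℕ) : ℤ) = (n * k : ℕ) := congrArg _ hk
      push_cast [Nat.cast_sub h2] at h3
      exact h3
    rw [P.ord_pow, ← hg₀, h1, Finsupp.smul_apply, nsmul_eq_mul]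
    ring
  have hordu (P : PrimeDivisor R) : P.ord (f ^ (c e * p ^ b) / g) =
      c e * p ^ b * (P.ord f - ((p : ℤ) - 1) * K P) := by
    rw [P.ord_div (pow_ne_zero _ hf0) hg0, P.ord_pow, hordg, ← hc]
    push_cast
    ring
  -- The effective divisor `c e * p ^ b * (div f - (p - 1) K)` is that of an element `u` of `R`.
  obtain ⟨u, hu⟩ := mem_range_algebraMap_of_forall_ord_nonneg (f := f ^ (c e * p ^ b) / g)
    fun P => by
      rw [hordu]
      have := hordf P
      exact mul_nonneg (by positivity) (by linarith)
  -- The map `r ↦ T^[b + e] (g * f ^ c b * r)` sends `R` to `R` and `u` to `1`, so `u` is a unit.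
  have hψmem (r : R) : T^[b + e] (g * f ^ c b * algebraMap R _ r) ∈
      (algebraMap R (FractionRing R)).range := by
    by_cases h0 : T^[b + e] (g * f ^ c b * algebraMap R _ r) = 0
    · rw [h0]
      exact zero_mem _
    refine mem_range_algebraMap_of_forall_ord_nonneg fun P => ?_
    have h1 := WeilDivisor.le_ord_iterate_trace hT hK P (K P) (b + e)
      (f := g * f ^ c b * algebraMap R _ r) (fun h => by
        have hr := right_ne_zero_of_mul h
        rw [P.ord_mul (left_ne_zero_of_mul h) hr, P.ord_mul hg0 (pow_ne_zero _ hf0), hordg,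
          P.ord_pow]
        have h2 := P.ord_algebraMap_nonneg r
        have h3 : (c b : ℤ) * (((p : ℤ) - 1) * K P) ≤ c b * P.ord f :=
          mul_le_mul_of_nonneg_left (hordf P) (by positivity)
        rw [← mul_assoc, hc] at h3
        have h4 : (p : ℤ) ^ (b + e) * K P =
            p ^ b * (p ^ e - 1) * K P + (p ^ b - 1) * K P + K P := by
          rw [pow_add]; ring
        linarith) h0
    linarith
  choose ψ hψ using hψmem
  have hTadd (j : ℕ) (x y : FractionRing R) : T^[j] (x + y) = T^[j] x + T^[j] y :=
    iterate_map_add T j x y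
  let ψ' : R →+ R := AddMonoidHom.mk' ψ fun r s => hinj (by
    rw [hψ, map_add, map_add, mul_add, hTadd, hψ, hψ])
  have hψ' : IsFrobeniusInverseLinear p (b + e) ψ' := fun r s => hinj (by
    change algebraMap R _ (ψ _) = algebraMap R _ (r * ψ s)
    rw [hψ, map_mul, map_mul, map_pow, mul_left_comm, WeilDivisor.iterate_trace_pow_mul hT, hψ])
  have hψu : ψ' u = 1 := hinj (by
    change algebraMap R _ (ψ u) = _
    rw [hψ, hu, ← hφiter (b + e), hiter, hcadd, pow_add, map_one, mul_one]
    congr 1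
    field_simp)
  have hunit : u ∉ IsLocalRing.maximalIdeal R := fun h => by
    have := hmax _ ψ' hψ' u h
    rw [hψu] at this
    exact (Ideal.ne_top_iff_one _).1 (IsLocalRing.maximalIdeal.isMaximal R).ne_top this
  refine ⟨f, hf0, fun P => ?_⟩
  have h1 : P.ord (algebraMap R (FractionRing R) u) = 0 :=
    P.ord_eq_zero_of_notMem fun h => hunit (IsLocalRing.le_maximalIdeal P.1.isPrime.ne_top h)
  rw [hu, hordu] at h1
  have hce : (c e : ℤ) ≠ 0 := by
    have : p ^ 0 ≤ c e := Finset.single_le_sum (f := fun i => p ^ i) (fun _ _ => Nat.zero_le _)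
      (Finset.mem_range.2 he)
    rw [pow_zero] at this
    lia
  have hpb : (p : ℤ) ^ b ≠ 0 := pow_ne_zero b (by exact_mod_cast hp.ne_zero)
  have h2 := (mul_eq_zero.1 h1).resolve_left (mul_ne_zero hce hpb)
  rw [Finsupp.smul_apply, nsmul_eq_mul, Nat.cast_sub hp.one_le]
  push_cast
  linarith

/-! ### Regular local rings -/

open IsLocalRing RingTheory.Sequence

lemma exists_isPrime_ringKrullDim_le_quotient {S : Type*} [CommRing S] {d : ℕ}
    (hd : d ≤ ringKrullDim S) : ∃ Q : Ideal S, Q.IsPrime ∧ d ≤ ringKrullDim (S ⧸ Q) := by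
  obtain ⟨l, hl⟩ := Order.le_krullDim_iff.1 hd
  refine ⟨l.head.asIdeal, l.head.isPrime, ?_⟩
  have h1 : PrimeSpectrum.zeroLocus (l.head.asIdeal : Set S) = Set.Ici l.head := by
    ext Q
    simp [PrimeSpectrum.mem_zeroLocus, ← PrimeSpectrum.asIdeal_le_asIdeal]
  rw [ringKrullDim_quotient, h1, ← Order.coheight_eq_krullDim_Ici]
  have h2 := Order.length_le_coheight_head (p := l)
  rw [hl] at h2
  exact_mod_cast h2

/-- A minimal generator `x` of the maximal ideal of a regular local ring `S` is a nonzerodivisor if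
`S ⧸ (x)` is a domain: a prime `Q` with `dim S ⧸ Q = dim S` is contained in `(x)` for reasons of
dimension and does not contain `x`, so that `Q = x Q`. -/
lemma isDomain_of_isDomain_quotient_span_singleton {S : Type*} [CommRing S] [IsLocalRing S]
    [IsNoetherianRing S] {x : S} (hx : x ∈ maximalIdeal S) [IsDomain (S ⧸ Ideal.span {x})] {d : ℕ}
    (hd : ringKrullDim (S ⧸ Ideal.span {x}) = d) (hd' : ringKrullDim S = (d + 1 : ℕ)) :
    IsDomain S := by
  obtain ⟨Q, hQ, hdim⟩ := exists_isPrime_ringKrullDim_le_quotient hd'.ge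
  have hxQ : x ∉ Q := fun h => by
    have h1 := ringKrullDim_le_of_surjective (Ideal.Quotient.factor
      ((Ideal.span_singleton_le_iff_mem Q).2 h)) (Ideal.Quotient.factor_surjective _)
    have h2 := hdim.trans (h1.trans hd.le)
    norm_cast at h2
    lia
  have hle : Q ≤ Ideal.span {x} := fun q hq => by
    by_contra hqx
    have : IsLocalRing (S ⧸ Q) := .of_surjective' _ Ideal.Quotient.mk_surjective
    have h1 := ringKrullDim_quotient_span_singleton_succ_eq_ringKrullDim_of_mem_nonZeroDivisors
      (x := Ideal.Quotient.mk Q x) (mem_nonZeroDivisors_of_ne_zero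
        (by rwa [ne_eq, Ideal.Quotient.eq_zero_iff_mem]))
      (by
        rw [← map_maximalIdeal_of_surjective (Ideal.Quotient.mk Q) Ideal.Quotient.mk_surjective]
        exact Ideal.mem_map_of_mem _ hx)
    let f : S ⧸ Ideal.span {x} →+* (S ⧸ Q) ⧸ Ideal.span {Ideal.Quotient.mk Q x} :=
      Ideal.Quotient.lift _ ((Ideal.Quotient.mk _).comp (Ideal.Quotient.mk Q)) fun a ha => by
        rw [RingHom.comp_apply, Ideal.Quotient.eq_zero_iff_mem, ← Set.image_singleton,
          ← Ideal.map_span]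
        exact Ideal.mem_map_of_mem _ ha
    have hf : Function.Surjective f := Ideal.Quotient.lift_surjective_of_surjective _ _
      (.comp (g := Ideal.Quotient.mk _) Ideal.Quotient.mk_surjective Ideal.Quotient.mk_surjective)
    have h2 := ringKrullDim_succ_le_of_surjective f hf
      (r := Ideal.Quotient.mk _ q) (mem_nonZeroDivisors_of_ne_zero
        (by rwa [ne_eq, Ideal.Quotient.eq_zero_iff_mem])) (by
          simp [f, Ideal.Quotient.eq_zero_iff_mem.2 hq])
    have h3 := hdim.trans (h1.ge.trans (h2.trans hd.le))
    norm_cast at h3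
    lia
  have hbot : Q = ⊥ := by
    refine Submodule.eq_bot_of_le_smul_of_le_jacobson_bot (Ideal.span {x}) _
      (IsNoetherian.noetherian Q) (fun q hq => ?_) ?_
    · obtain ⟨a, rfl⟩ := Ideal.mem_span_singleton'.1 (hle hq)
      rw [mul_comm]
      exact Submodule.smul_mem_smul (Ideal.mem_span_singleton_self x)
        ((hQ.mem_or_mem hq).resolve_right hxQ)
    · rw [IsLocalRing.jacobson_eq_maximalIdeal _ bot_ne_top]
      exact (Ideal.span_singleton_le_iff_mem _).2 hx
  subst hbot
  exact .of_bot_isPrime S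

lemma isWeaklyRegular_cons_self_iff {S : Type*} [CommRing S] (x : S) (rs : List S) :
    IsWeaklyRegular S (x :: rs) ↔ IsSMulRegular S x ∧
      IsWeaklyRegular (S ⧸ Ideal.span {x}) (rs.map (Ideal.Quotient.mk (Ideal.span {x}))) := by
  rw [isWeaklyRegular_cons_iff]
  refine and_congr_right' (Iff.trans ?_
    (isWeaklyRegular_map_algebraMap_iff (S ⧸ Ideal.span {x}) _ rs).symm)
  exact (Submodule.quotEquivOfEq _ _ (by
    rw [← Submodule.ideal_span_singleton_smul, smul_eq_mul, Ideal.mul_top])).isWeaklyRegular_congr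
    rs

/-- A regular local ring is a domain, and its maximal ideal is generated by a regular sequence. -/
theorem IsRegularLocalRing.isDomain_and_exists_isWeaklyRegular (S : Type*) [CommRing S]
    [IsRegularLocalRing S] :
    IsDomain S ∧ ∃ rs : List S, IsWeaklyRegular S rs ∧ Ideal.ofList rs = maximalIdeal S := by
  obtain ⟨d, hd⟩ : ∃ d, (maximalIdeal S).spanFinrank = d := ⟨_, rfl⟩
  induction d generalizing S with
  | zero =>
    have h0 : maximalIdeal S = ⊥ :=
      (Submodule.spanFinrank_eq_zero_iff_eq_bot (IsNoetherian.noetherian _)).1 hd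
    exact ⟨(isField_iff_maximalIdeal_eq.2 h0).isDomain, [], .nil S S, by rw [h0, Ideal.ofList_nil]⟩
  | succ d ih =>
    classical
    have hdim : ringKrullDim S = (d + 1 : ℕ) := by
      rw [← IsRegularLocalRing.spanFinrank_maximalIdeal, hd]
    obtain ⟨s, hs, hspan⟩ := Submodule.FG.exists_span_finset_card_eq_spanFinrank
      (IsNoetherian.noetherian (maximalIdeal S))
    rw [hd] at hs
    obtain ⟨x, hx⟩ := Finset.card_pos.1 (by lia : 0 < s.card)
    have hxm : x ∈ maximalIdeal S := hspan ▸ Submodule.subset_span hx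
    have hle : Ideal.span {x} ≤ maximalIdeal S := (Ideal.span_singleton_le_iff_mem _).2 hxm
    have : Nontrivial (S ⧸ Ideal.span {x}) := Ideal.Quotient.nontrivial_iff.2
      (ne_top_of_le_ne_top (Ideal.IsPrime.ne_top') hle)
    have : IsLocalRing (S ⧸ Ideal.span {x}) := .of_surjective' _ Ideal.Quotient.mk_surjective
    have hmax : maximalIdeal (S ⧸ Ideal.span {x}) =
        (maximalIdeal S).map (Ideal.Quotient.mk (Ideal.span {x})) :=
      (map_maximalIdeal_of_surjective _ Ideal.Quotient.mk_surjective).symm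
    have hrank : (maximalIdeal (S ⧸ Ideal.span {x})).spanFinrank ≤ d := by
      have h1 : maximalIdeal (S ⧸ Ideal.span {x}) =
          Ideal.span ((s.erase x).image (Ideal.Quotient.mk (Ideal.span {x}))) := by
        rw [hmax, ← hspan, ← Ideal.span, Ideal.map_span, ← Finset.insert_erase hx,
          Finset.coe_insert, Set.image_insert_eq, Ideal.Quotient.eq_zero_iff_mem.2
            (Ideal.mem_span_singleton_self x), Ideal.span_insert, Ideal.span_singleton_zero]
        simp
      rw [h1]
      refine (Submodule.spanFinrank_span_le_ncard_of_finite (Finset.finite_toSet _)).trans ?_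
      rw [Set.ncard_coe_finset]
      refine Finset.card_image_le.trans ?_
      rw [Finset.card_erase_of_mem hx, hs, Nat.add_sub_cancel]
    have hdim1 : ringKrullDim S ≤ ringKrullDim (S ⧸ Ideal.span {x}) + 1 := by
      rw [← maximalIdeal_height_eq_ringKrullDim]
      exact Ideal.height_le_ringKrullDim_quotient_add_one hxm
    have hdim2 : (d : WithBot ℕ∞) ≤ ringKrullDim (S ⧸ Ideal.span {x}) := by
      rw [hdim] at hdim1
      push_cast at hdim1
      exact ENat.WithBot.add_le_add_one_right_iff.1 hdim1
    have hdim3 := ringKrullDim_le_spanFinrank_maximalIdeal (S ⧸ Ideal.span {x})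
    have hrank' : (maximalIdeal (S ⧸ Ideal.span {x})).spanFinrank = d :=
      le_antisymm hrank (by exact_mod_cast hdim2.trans hdim3)
    have := IsRegularLocalRing.of_spanFinrank_maximalIdeal_le (S ⧸ Ideal.span {x})
      (by rwa [hrank'])
    obtain ⟨hdom, rs, hrs, hrs'⟩ := ih (S ⧸ Ideal.span {x}) hrank'
    have : IsDomain S := isDomain_of_isDomain_quotient_span_singleton hxm
      (le_antisymm (hrank' ▸ hdim3) hdim2) hdim
    refine ⟨this, ?_⟩
    obtain ⟨rs, rfl⟩ := List.map_surjective_iff.2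
      (Ideal.Quotient.mk_surjective (I := Ideal.span {x})) rs
    -- For `x = 0` the quotient `S ⧸ (x)` would have the dimension of `S`.
    have hx0 : x ≠ 0 := by
      rintro rfl
      have h1 := ringKrullDim_le_of_surjective (Ideal.Quotient.lift (Ideal.span {(0 : S)})
        (RingHom.id S) (by simp)) (Ideal.Quotient.lift_surjective_of_surjective _ _
          Function.surjective_id)
      have h2 := hdim.ge.trans (h1.trans (hdim3.trans (Nat.cast_le.2 hrank)))
      norm_cast at h2
      lia
    refine ⟨x :: rs, (isWeaklyRegular_cons_self_iff x rs).2
      ⟨isSMulRegular_iff_right_eq_zero_of_smul.2 fun y hy =>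
        (mul_eq_zero.1 hy).resolve_left hx0, hrs⟩, ?_⟩
    rw [← Ideal.map_ofList, hmax] at hrs'
    rw [Ideal.ofList_cons]
    have := congrArg (Ideal.comap (Ideal.Quotient.mk (Ideal.span {x}))) hrs'
    rw [Ideal.comap_map_of_surjective' _ Ideal.Quotient.mk_surjective, Ideal.mk_ker,
      Ideal.comap_map_of_surjective' _ Ideal.Quotient.mk_surjective, Ideal.mk_ker,
      sup_eq_left.2 hle] at this
    rw [sup_comm, this]

/-- In a local ring, regular sequences may be permuted, so the terms of a regular sequence may be
replaced by powers one at a time. -/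
lemma RingTheory.Sequence.IsWeaklyRegular.map_pow {S M : Type*} [CommRing S] [IsLocalRing S]
    [AddCommGroup M] [Module S M] [IsNoetherian S M] {rs : List S} (hrs : IsWeaklyRegular M rs)
    (hmem : ∀ r ∈ rs, r ∈ maximalIdeal S) {n : ℕ} (hn : n ≠ 0) :
    IsWeaklyRegular M (rs.map (· ^ n)) := by
  suffices H : ∀ l l' : List S, IsWeaklyRegular M (l' ++ l) → (∀ r ∈ l' ++ l, r ∈ maximalIdeal S) →
      IsWeaklyRegular M (l' ++ l.map (· ^ n)) from H rs [] hrs hmem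
  intro l
  induction l with
  | nil => exact fun _ h _ => h
  | cons a l ih =>
    intro l' h hmem
    have h1 := IsLocalRing.isWeaklyRegular_of_perm_of_subset_maximalIdeal
      (rs' := (l' ++ l) ++ [a]) h
      (List.perm_middle.trans (List.perm_append_singleton a _).symm) hmem
    rw [isWeaklyRegular_append_iff, isWeaklyRegular_singleton_iff] at h1
    have h2 : IsWeaklyRegular M ((l' ++ l) ++ [a ^ n]) := by
      rw [isWeaklyRegular_append_iff, isWeaklyRegular_singleton_iff]
      exact ⟨h1.1, h1.2.pow n⟩
    have han : a ^ n ∈ maximalIdeal S := Ideal.pow_mem_of_mem _ (hmem a (by simp)) n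
      (Nat.pos_of_ne_zero hn)
    have hmem' : ∀ r ∈ l' ++ l, r ∈ maximalIdeal S := fun r hr => hmem r (by
      simp only [List.mem_append, List.mem_cons] at hr ⊢
      tauto)
    have h3 := IsLocalRing.isWeaklyRegular_of_perm_of_subset_maximalIdeal
      (rs' := (l' ++ [a ^ n]) ++ l) h2 (by
        rw [List.append_assoc, List.append_assoc]
        exact (List.perm_append_comm).append_left l') (by
        intro r hr
        rcases List.mem_append.1 hr with hr | hr
        · exact hmem' r hr
        · rwa [List.mem_singleton.1 hr])
    have h4 := ih _ h3 (by
      intro r hr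
      simp only [List.mem_append, List.mem_singleton] at hr hmem'
      rcases hr with (hr | rfl) | hr
      exacts [hmem' r (.inl hr), han, hmem' r (.inr hr)])
    simpa using h4

/-- A finitely generated module over a local ring on which a regular sequence that generates the
maximal ideal is again regular is free. -/
theorem RingTheory.Sequence.IsWeaklyRegular.free {S M : Type*} [CommRing S] [IsLocalRing S]
    [IsNoetherianRing S] [AddCommGroup M] [Module S M] [Module.Finite S M] {rs : List S}
    (hS : IsWeaklyRegular S rs) (hM : IsWeaklyRegular M rs)
    (hrs : Ideal.ofList rs = maximalIdeal S) : Module.Free S M := by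
  obtain ⟨n, hn⟩ : ∃ n, rs.length = n := ⟨_, rfl⟩
  induction n generalizing S M with
  | zero =>
    rw [List.length_eq_zero_iff] at hn
    subst hn
    rw [Ideal.ofList_nil, eq_comm, ← isField_iff_maximalIdeal_eq] at hrs
    let := hrs.toField
    exact Module.Free.of_divisionRing S M
  | succ n ih =>
    obtain ⟨x, rs, rfl⟩ := List.exists_cons_of_length_eq_add_one hn
    have hle : Ideal.span {x} ≤ maximalIdeal S := by
      rw [← hrs, Ideal.ofList_cons]
      exact le_sup_left
    have : Nontrivial (S ⧸ Ideal.span {x}) := Ideal.Quotient.nontrivial_iff.2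
      (ne_top_of_le_ne_top (Ideal.IsPrime.ne_top') hle)
    have : IsLocalRing (S ⧸ Ideal.span {x}) := .of_surjective' _ Ideal.Quotient.mk_surjective
    rw [isWeaklyRegular_cons_iff'] at hM
    have : Module.FinitePresentation S M := Module.finitePresentation_of_finite S M
    refine (Module.free_quotSMulTop_iff_free S M ?_ hM.1).1 ?_
    · rw [IsLocalRing.jacobson_eq_maximalIdeal _ bot_ne_top]
      exact (Ideal.span_singleton_le_iff_mem _).1 hle
    · have := Module.Finite.of_restrictScalars_finite S (S ⧸ Ideal.span {x}) (QuotSMulTop x M)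
      refine ih ((isWeaklyRegular_cons_self_iff x rs).1 hS).2 hM.2 ?_ (by simpa using hn)
      rw [← Ideal.map_ofList, ← map_maximalIdeal_of_surjective _
        (Ideal.Quotient.mk_surjective (I := Ideal.span {x})), ← hrs, Ideal.ofList_cons,
        Ideal.map_sup, Ideal.map_quotient_self, bot_sup_eq]

/-- A regular local ring is free over itself through the Frobenius map, if the latter is finite. -/
theorem IsRegularLocalRing.free_frobeniusPushforward (p e : ℕ) [Fact p.Prime] (S : Type*)
    [CommRing S] [IsRegularLocalRing S] [CharP S p] (hF : (frobenius S p).Finite) :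
    Module.Free S (FrobeniusPushforward p e S) := by
  obtain ⟨-, rs, hrs, hrs'⟩ := IsRegularLocalRing.isDomain_and_exists_isWeaklyRegular S
  have := FrobeniusPushforward.finite p e S hF
  refine hrs.free ?_ hrs'
  rw [← isWeaklyRegular_map_algebraMap_iff (FrobeniusPushforward p e S)]
  exact hrs.map_pow (fun r hr => hrs' ▸ Ideal.subset_span hr)
    (pow_ne_zero e (Fact.out : p.Prime).ne_zero)

/-- An F-finite regular local ring is strongly F-regular: if `e` is so large that `c` is not in the
`p ^ e`-th power of the maximal ideal, then `c` has a unit among its coordinates in a basis of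
`F^e_* S`. -/
theorem IsRegularLocalRing.isStronglyFRegular {p : ℕ} [Fact p.Prime] {S : Type*}
    [CommRing S] [IsRegularLocalRing S] [CharP S p] (hF : (frobenius S p).Finite) :
    IsStronglyFRegular p S := by
  intro c hc
  have := (IsRegularLocalRing.isDomain_and_exists_isWeaklyRegular S).1
  have hc0 : c ≠ 0 := fun h => hc ⊥ (by simp [IsDomain.minimalPrimes_eq_singleton_bot])
    (by simp [h])
  have hp := (Fact.out : p.Prime)
  obtain ⟨n, hn⟩ : ∃ n, c ∉ maximalIdeal S ^ n := by
    by_contra! h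
    have h1 := (Submodule.mem_iInf _).2 h
    rw [Ideal.iInf_pow_eq_bot_of_isLocalRing _ Ideal.IsPrime.ne_top'] at h1
    exact hc0 h1
  refine ⟨n + 1, n.succ_pos, ?_⟩
  have hq : c ∉ maximalIdeal S ^ p ^ (n + 1) := fun h => hn (Ideal.pow_le_pow_right
    (n.le_succ.trans (Nat.lt_pow_self hp.one_lt).le) h)
  have := FrobeniusPushforward.finite p (n + 1) S hF
  have := IsRegularLocalRing.free_frobeniusPushforward p (n + 1) S hF
  let b := Module.Free.chooseBasis S (FrobeniusPushforward p (n + 1) S)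
  let c' : FrobeniusPushforward p (n + 1) S := c
  obtain ⟨i, hi⟩ : ∃ i, IsUnit (b.repr c' i) := by
    by_contra! h
    refine hq ?_
    have h1 : c = ∑ i, b.repr c' i ^ p ^ (n + 1) * (show S from b i) := (b.sum_repr c').symm
    rw [h1]
    exact Ideal.sum_mem _ fun i _ => Ideal.mul_mem_right _ _ (Ideal.pow_mem_pow
      ((IsLocalRing.mem_maximalIdeal _).2 (h i)) _)
  obtain ⟨v, hv⟩ := hi.exists_left_inv
  refine ⟨((v • b.coord i).toAddMonoidHom : FrobeniusPushforward p (n + 1) S →+ S),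
    fun r s => ?_, hv⟩
  exact (v • b.coord i).map_smul r s

lemma RingHom.Finite.frobenius_of_isLocalization {p : ℕ} [Fact p.Prime] {R : Type*} [CommRing R]
    [CharP R p] (hF : (frobenius R p).Finite) (M : Submonoid R) (S : Type*) [CommRing S]
    [Algebra R S] [IsLocalization M S] [CharP S p] : (frobenius S p).Finite := by
  classical
  obtain ⟨T, hT⟩ := exists_frobenius_generators hF 1
  rw [pow_one] at hT
  suffices H : Module.Finite S (FrobeniusPushforward p 1 S) by
    rw [← iterateFrobenius_one]
    exact H
  let T' : Finset (FrobeniusPushforward p 1 S) := T.image (algebraMap R S)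
  refine Module.finite_def.2 ⟨T', top_le_iff.1 fun (x : S) _ => ?_⟩
  obtain ⟨r, u, rfl⟩ := IsLocalization.exists_mk'_eq M x
  obtain ⟨a, ha⟩ := hT (r * u ^ (p - 1))
  have h1 : IsLocalization.mk' S r u =
      ∑ t ∈ T, IsLocalization.mk' S (a t) u ^ p ^ 1 * algebraMap R S t := by
    have hu : IsUnit (algebraMap R S u ^ p) := (IsLocalization.map_units S u).pow p
    refine hu.mul_left_cancel ?_
    have h2 : algebraMap R S u ^ p = algebraMap R S u ^ (p - 1) * algebraMap R S u := by
      rw [← pow_succ, Nat.sub_add_cancel (Fact.out : p.Prime).one_le]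
    rw [Finset.mul_sum]
    simp_rw [pow_one, ← mul_assoc, ← mul_pow, IsLocalization.mk'_spec']
    rw [h2, mul_assoc, IsLocalization.mk'_spec', ← map_pow, ← map_mul, mul_comm, ha, map_sum]
    simp
  rw [h1]
  exact Submodule.sum_mem _ fun t ht => Submodule.smul_mem _ (IsLocalization.mk' S (a t) u)
    (Submodule.subset_span (Finset.mem_coe.2 (Finset.mem_image_of_mem _ ht)))

/-! ### The characteristic modulo the index -/

/-- The index divides every `m` with `m K ∼ 0`, and `(p - 1) K ∼ 0`. -/
theorem IsQGorensteinOfIndex.modEq_one {R : Type u} [CommRing R] [IsDomain R] [IsNoetherianRing R]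
    [IsLocalRing R] [IsIntegrallyClosed R] {p : ℕ} [Fact p.Prime] [CharP R p]
    (hF : (frobenius R p).Finite) {n : ℕ} (hindex : IsQGorensteinOfIndex R n)
    (hpure : IsFPure p R) (hnot : ¬ IsStronglyFRegular p R)
    (hloc : ∀ (P : Ideal R) [P.IsPrime], P ≠ IsLocalRing.maximalIdeal R →
      IsStronglyFRegular p (Localization.AtPrime P)) : p ≡ 1 [MOD n] := by
  obtain ⟨K, hK, hn⟩ := hindex
  obtain ⟨Ψ, hΨ, hlin, hsmul, hsurj⟩ := IsCanonicalModule.exists_frobenius_duality p hF hK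
  obtain ⟨T, hT, hTK, hTK', hrep⟩ :=
    exists_frobenius_trace K.divisorialIdeal_ne_bot hΨ hlin hsmul hsurj
  have hdvd := WeilDivisor.dvd_of_isPrincipal hn (WeilDivisor.isPrincipal_sub_one_smul hF hpure
    (fun e φ hφ c hc => hφ.apply_mem_maximalIdeal hF hpure hnot hloc hc) hT hTK hTK' hrep
    hn.1.1 hn.1.2)
  exact ((Nat.modEq_iff_dvd' (Fact.out : p.Prime).one_le).2 hdvd).symm

theorem mainTheorem2 (R : Type u) [CommRing R] [IsDomain R] [IsNoetherianRing R] [IsLocalRing R]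
    [IsIntegrallyClosed R] (p : ℕ) [Fact p.Prime] [CharP R p]
    (hFfinite : (frobenius R p).Finite)
    (n : ℕ) (hindex : IsQGorensteinOfIndex R n)
    (hFpure : IsFPure p R) (hnotFregular : ¬ IsStronglyFRegular p R) :
    ((∀ (P : Ideal R) [P.IsPrime], P ≠ IsLocalRing.maximalIdeal R →
        IsStronglyFRegular p (Localization.AtPrime P)) → p ≡ 1 [MOD n]) ∧
    ((∀ (P : Ideal R) [P.IsPrime], P ≠ IsLocalRing.maximalIdeal R →
        IsRegularLocalRing (Localization.AtPrime P)) → p ≡ 1 [MOD n]) := by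
  refine ⟨hindex.modEq_one hFfinite hFpure hnotFregular, fun hreg =>
    hindex.modEq_one hFfinite hFpure hnotFregular fun P _ hP => ?_⟩
  have := hreg P hP
  have : CharP (Localization.AtPrime P) p := charP_of_injective_algebraMap
    (IsLocalization.injective _ P.primeCompl_le_nonZeroDivisors) p
  exact IsRegularLocalRing.isStronglyFRegular
    (hFfinite.frobenius_of_isLocalization P.primeCompl (Localization.AtPrime P))
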